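/- **Conventions.** Let a group $G$ act by homeomorphisms on a space $X$; put $\mathrm{supp}(g)=\{x\in X: g(x)\neq x\}$, $\mathrm{supp}(g)^1=\mathrm{supp}(g)$ and $\mathrm{supp}(g)^0=\mathrm{int}(X\setminus \mathrm{supp}(g))$. A word over $G$ in $m$ variables is an element $w$ of $\mathbb F_m * G$, where $\mathbb F_m$ is free on $y_1,\dots,y_m$; $w(\bar h)$ denotes its value under $y_i\mapsto h_i$. If $w\notin\mathbb F_m$, let $u\in\mathbb F_m$ be the (possibly empty) string of variables with which the reduced form of $w$ ends on the right, and write $uwu^{-1}=u_kv_k\cdots u_1v_1$ in reduced form with $k\ge 1$, $v_i\in G\setminus\{1\}$, $u_i\in\mathbb F_m$, $u_i\ne 1$ for $i<k$ (while $u_k$ may be trivial); this is the *standard form* of $w$. Put $O_w=\bigcap_{i=0}^{k-1}v_1^{-1}\cdots v_i^{-1}(\mathrm{supp}(v_{i+1}))$. * For $V\subseteq X$, a word $w\neq 1$ is *oscillating in $V$* if $w\in\mathbb F_m$, or $w\notin \mathbb F_m$ and $V\cap O_w\neq\emptyset$. It is *oscillating* if it is oscillating in $X$. * Starting with the pair $(X,w)$,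 form pairs (set, word) in successive stages: a pair $(V,w_V)$ with $w_V\notin\mathbb F_m$ of standard form $u_kv_k\cdots u_1v_1$ is replaced by all pairs $(V\cap X_{\bar\varepsilon},\,u_kv_k^{\varepsilon_k}\cdots u_1v_1^{\varepsilon_1})$, $\bar\varepsilon\in\{0,1\}^k$, with $V\cap X_{\bar\varepsilon}\ne\emptyset$, where $X_{\bar\varepsilon}=\bigcap_{i=1}^k v_1^{-1}\cdots v_{i-1}^{-1}(\mathrm{supp}(v_i)^{\varepsilon_i})$. The word $w$ is *almost oscillating* if it is not oscillating and at some stage there is a pair $(V,w_V)$ such that $w_V\neq1$ is oscillating in $V$. * $w$ has *non-trivial product of constants* if deleting all variables from $w$ gives a non-trivial element of $G$. Let $W$ be a set of words over $G$ in $m$ variables, let $G_n$ ($n\in\mathbb N$) and $\mathbb G$ be groups containing $G$, and let $\bar g_n\in G_n^m$, $\bar g\in\mathbb G^m$. Then $\mathbb G$ (with $\bar g$) is a *$W$-limit* of the sequence $(G_n,\bar g_n)$ if for every $w\in W$, for all but finitely many $n$: $w(\bar g_n)=1$ in $G_n$ if and only if $w(\bar g)=1$ in $\mathbb G$. Thompson's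 group $F$ is the group (under composition) of increasing piecewise linear homeomorphisms of $[0,1]$ with finitely many break points, all dyadic, and all slopes integer powers of $2$; $x_0$ is the map $t\mapsto t/2$ on $[0,\frac12]$, $t-\frac14$ on $[\frac12,\frac34]$, $2t-1$ on $[\frac34,1]$, and $x_1$ is the identity on $[0,\frac12]$ and $t\mapsto \frac t2+\frac14$ on $[\frac12,\frac34]$, $t-\frac18$ on $[\frac34,\frac78]$, $2t-1$ on $[\frac78,1]$. The first Grigorchuk group $\Gamma=\langle a,b,c,d\rangle$ acts on the boundary $\{0,1\}^{\mathbb N}$ of the infinite rooted binary tree: $a$ switches the first digit, and $b(0\xi)=0a(\xi)$, $b(1\xi)=1c(\xi)$, $c(0\xi)=0a(\xi)$, $c(1\xi)=1d(\xi)$, $d(0\xi)=0\xi$, $d(1\xi)=1b(\xi)$. **Corollary 3.4.** (1) Let $W$ be a set of words over $F$ in $m$ variables, each of which is oscillating, almost oscillating or has non-trivial product of constants, with respect to the action of $F$ on $[0,1]$. Then there are $g_{n,i}\in F$ ($n\in\mathbb N$, $1\le i\le m$) such that each $(F,(g_{n,1},\dots,g_{n,m},x_0,x_1))$ is a marked group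 (i.e. the listed elements generate $F$) and the free product $\mathbb F_m*F$, where $\mathbb F_m=\langle g_1,\dots,g_m\rangle$ is free on $g_1,\dots,g_m$, with the tuple $(g_1,\dots,g_m)$, is a $W$-limit of this sequence. (2) Let $W$ be a set of words over $\Gamma$ in $m$ variables, each of which is oscillating, almost oscillating or has non-trivial product of constants, with respect to the action of $\Gamma$ on the boundary $\{0,1\}^{\mathbb N}$. Then there are $g_{n,i}\in\Gamma$ ($n\in\mathbb N$, $1\le i\le m$) such that each $(\Gamma,(g_{n,1},\dots,g_{n,m},a,b,c,d))$ is a marked group and $\mathbb F_m*\Gamma$, with $\mathbb F_m=\langle g_1,\dots,g_m\rangle$ free on $g_1,\dots,g_m$, with the tuple $(g_1,\dots,g_m)$, is a $W$-limit of this sequence. -/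

import Mathlib

noncomputable section

/-! ### Words with constants and their evaluation -/

namespace WordLimit

open Monoid Set

/-- Words over the group `G` in the variables `y_1, …, y_m`: elements of `𝔽_m ∗ G`. -/
abbrev Word (m : ℕ) (G : Type*) [Group G] := Coprod (FreeGroup (Fin m)) G

variable {m : ℕ} {G : Type*} [Group G]

/-- The value `w(h_1, …, h_m)` of a word with constants from `G` in a group `H`, where the
constants are interpreted in `H` through the homomorphism `j : G →* H`. -/
def eval {H : Type*} [Group H] (j : G →* H) (h : Fin m → H) : Word m G →* H :=
  Coprod.lift (FreeGroup.lift h) j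

/-- Words `w ∈ 𝔽_m`, i.e. words without constants. -/
def NoConstants (w : Word m G) : Prop :=
  ∃ u : FreeGroup (Fin m), w = Coprod.inl u

/-- The word `u_k v_k ⋯ u_1 v_1`, for the list `[(u_1, v_1), …, (u_k, v_k)]`. -/
def toWord : List (FreeGroup (Fin m) × G) → Word m G
  | [] => 1
  | (u, v) :: L => toWord L * (Coprod.inl u * Coprod.inr v)

/-- `u_k v_k ⋯ u_1 v_1` is a reduced expression with `k ≥ 1`: all constants `v_i` are non-trivial,
and all `u_i` are non-trivial, except that the leftmost one `u_k` may be empty. -/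
def IsReducedForm (L : List (FreeGroup (Fin m) × G)) : Prop :=
  L ≠ [] ∧ (∀ p ∈ L, p.2 ≠ 1) ∧ ∀ p ∈ L.dropLast, p.1 ≠ 1

/-- `L` is the standard form `u_k v_k ⋯ u_1 v_1` of the word `w ∉ 𝔽_m`. If `w` ends (on the right)
with a string `u` of variables, then `u` is first moved to the left end by conjugation, so that
`u w u⁻¹ = u_k v_k ⋯ u_1 v_1`; if `w` ends with a constant then `u = 1`. -/
def IsStandardForm (w : Word m G) (L : List (FreeGroup (Fin m) × G)) : Prop :=
  IsReducedForm L ∧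
    ∃ u : FreeGroup (Fin m), Coprod.inl u * w * (Coprod.inl u)⁻¹ = toWord L

/-! ### Oscillating words, almost oscillating words, non-trivial product of constants -/

section Action

variable (X : Type*) [MulAction G X]

/-- `supp(g) = {x | g x ≠ x}`. -/
def supp (g : G) : Set X := (MulAction.fixedBy X g)ᶜ

variable {X}

/-- `⋂_{0 ≤ i < k} v_1⁻¹ ⋯ v_i⁻¹ (supp v_{i+1})`: the points `x` with `x ∈ supp v_1`,
`v_1 x ∈ supp v_2`, …, `v_{k-1} ⋯ v_1 x ∈ supp v_k`. -/
def oscSet : List (FreeGroup (Fin m) × G) → Set X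
  | [] => univ
  | (_, v) :: L => supp X v ∩ (fun x => v • x) ⁻¹' oscSet L

/-- The non-trivial word `w` is oscillating in `V ⊆ X`: either it has no constants or
`V ∩ ⋂_i v_1⁻¹ ⋯ v_i⁻¹ (supp v_{i+1})` is non-empty. -/
def IsOscillatingIn (V : Set X) (w : Word m G) : Prop :=
  w ≠ 1 ∧ (NoConstants w ∨ ∃ L, IsStandardForm w L ∧ (V ∩ oscSet L).Nonempty)

variable (X) in
/-- Oscillating words. -/
def IsOscillating (w : Word m G) : Prop :=
  IsOscillatingIn (univ : Set X) w

variable [TopologicalSpace X]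

variable (X) in
/-- `supp(v)^1 = supp(v)` and `supp(v)^0 = int (X ∖ supp(v))`. -/
def suppPow (v : G) (e : Bool) : Set X :=
  if e then supp X v else interior (supp X v)ᶜ

/-- The set `X_ε = ⋂_{1 ≤ i ≤ k} v_1⁻¹ ⋯ v_{i-1}⁻¹ (supp(v_i)^{ε_i})`. -/
def cell : List (FreeGroup (Fin m) × G) → List Bool → Set X
  | (_, v) :: L, e :: ε => suppPow X v e ∩ (fun x => v • x) ⁻¹' cell L ε
  | _, _ => univ

/-- The expression `u_k v_k^{ε_k} ⋯ u_1 v_1^{ε_1}`. -/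
def deleteConstants (L : List (FreeGroup (Fin m) × G)) (ε : List Bool) :
    List (FreeGroup (Fin m) × G) :=
  List.zipWith (fun p e => (p.1, if e then p.2 else 1)) L ε

/-- `Stage w n V w'`: after `n` steps of the splitting procedure started with `(X, w)`, the set `V`
is one of the (non-empty) pieces and `w' = w_V` is its word. In one step a piece `V` whose word has
the standard form `u_k v_k ⋯ u_1 v_1` is replaced by the non-empty sets among
`V ∩ X_ε`, `ε ∈ {0,1}^k`, with the words `u_k v_k^{ε_k} ⋯ u_1 v_1^{ε_1}`. (These are elements of
`𝔽_m ∗ G`, so no reduction is needed; the rotation of the reduced word is part of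
`IsStandardForm`. A word without constants is not changed any more.) -/
inductive Stage (w : Word m G) : ℕ → Set X → Word m G → Prop
  | zero : Stage w 0 univ w
  | succ {n : ℕ} {V : Set X} {w' : Word m G} {L : List (FreeGroup (Fin m) × G)} {ε : List Bool}
      (h : Stage w n V w') (hL : IsStandardForm w' L) (hε : ε.length = L.length)
      (hV : (V ∩ cell L ε).Nonempty) :
      Stage w (n + 1) (V ∩ cell L ε) (toWord (deleteConstants L ε))

variable (X) in
/-- Almost oscillating words: `w` is not oscillating, but at some stage of the procedure there is a
piece `V` such that `w_V` is non-trivial and oscillating in `V`. (The procedure is stopped at the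
first stage where this happens; it happens at some stage iff it happens at a first one.) -/
def IsAlmostOscillating (w : Word m G) : Prop :=
  ¬ IsOscillating X w ∧
    ∃ (n : ℕ) (V : Set X) (w' : Word m G), Stage w n V w' ∧ IsOscillatingIn V w'

end Action

/-- `w` has non-trivial product of constants: `v_k ⋯ v_1 ≠ 1`, i.e. deleting all the variables from
`w` leaves a non-trivial element of `G`. -/
def HasNontrivialProduct (w : Word m G) : Prop :=
  (Coprod.snd w : G) ≠ 1

/-! ### Relative limits -/

/-- Let `H n`, `n ∈ ℕ`, be groups containing a copy of `G` (through `j n`), each with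
an `m`-tuple `h n`, and let `L` be a group containing a copy of `G` (through `k`), with an `m`-tuple
`l`. Then `L` is a `W`-limit of the sequence if for every `w ∈ W`, for all but finitely many `n`,
`w(h n) = 1` in `H n` if and only if `w(l) = 1` in `L`. -/
def IsWLimit (W : Set (Word m G)) {H : ℕ → Type*} [∀ n, Group (H n)] (j : ∀ n, G →* H n)
    (h : ∀ n, Fin m → H n) {L : Type*} [Group L] (k : G →* L) (l : Fin m → L) : Prop :=
  ∀ w ∈ W, ∀ᶠ n in Filter.atTop, (eval (j n) (h n) w = 1 ↔ eval k l w = 1)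

end WordLimit

/-! ### Thompson's group `F` -/

namespace Thompson

/-- Dyadic rational numbers. -/
def IsDyadic (x : ℝ) : Prop := ∃ (z : ℤ) (n : ℕ), x = z / 2 ^ n

theorem IsDyadic.add {x y : ℝ} (hx : IsDyadic x) (hy : IsDyadic y) : IsDyadic (x + y) := by
  obtain ⟨z, n, rfl⟩ := hx
  obtain ⟨w, k, rfl⟩ := hy
  refine ⟨z * 2 ^ k + w * 2 ^ n, n + k, ?_⟩
  rw [pow_add]
  push_cast
  field_simp

theorem IsDyadic.neg {x : ℝ} (hx : IsDyadic x) : IsDyadic (-x) := by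
  obtain ⟨z, n, rfl⟩ := hx
  exact ⟨-z, n, by push_cast; ring⟩

theorem IsDyadic.sub {x y : ℝ} (hx : IsDyadic x) (hy : IsDyadic y) : IsDyadic (x - y) := by
  rw [sub_eq_add_neg]
  exact hx.add hy.neg

theorem isDyadic_zero : IsDyadic 0 := ⟨0, 0, by simp⟩

theorem isDyadic_one : IsDyadic 1 := ⟨1, 0, by simp⟩

theorem IsDyadic.zpow_mul {x : ℝ} (hx : IsDyadic x) (k : ℤ) : IsDyadic ((2 : ℝ) ^ k * x) := by
  obtain ⟨z, n, rfl⟩ := hx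
  obtain ⟨k, rfl | rfl⟩ := k.eq_nat_or_neg
  · exact ⟨2 ^ k * z, n, by push_cast; rw [zpow_natCast]; ring⟩
  · refine ⟨z, n + k, ?_⟩
    rw [zpow_neg, zpow_natCast, pow_add]
    field_simp

/-- `f` is affine, with slope an integer power of `2`, on every closed interval `[a, b] ⊆ [0, 1]`
with no point of `S` in its interior. -/
def AffineOff (f : unitInterval ≃o unitInterval) (S : Finset unitInterval) : Prop :=
  ∀ a b : unitInterval, a ≤ b → (∀ s ∈ S, ¬ (a < s ∧ s < b)) →
    ∃ (k : ℤ) (c : ℝ), ∀ x, a ≤ x → x ≤ b → (f x : ℝ) = 2 ^ k * (x : ℝ) + c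

/-- The strictly increasing bijections of `[0, 1]` that are piecewise linear with finitely many
break points, all of them dyadic, and all of whose slopes are integer powers of `2`. -/
def IsDyadicPL (f : unitInterval ≃o unitInterval) : Prop :=
  ∃ S : Finset unitInterval, (∀ s ∈ S, IsDyadic s) ∧ AffineOff f S

theorem map_zero' (f : unitInterval ≃o unitInterval) : f 0 = 0 := f.map_bot

theorem IsDyadicPL.isDyadic_iff {f : unitInterval ≃o unitInterval} (hf : IsDyadicPL f)
    (x : unitInterval) : IsDyadic (f x) ↔ IsDyadic x := by
  obtain ⟨S, hS, hA⟩ := hf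
  induction hn : (S.filter (· < x)).card using Nat.strong_induction_on generalizing x with
  | _ n ih =>
    subst hn
    -- a dyadic point `s ≤ x` with dyadic image and with no break point between `s` and `x`
    obtain ⟨s, hsx, hs, hfs, hno⟩ : ∃ s : unitInterval, s ≤ x ∧ IsDyadic s ∧ IsDyadic (f s) ∧
        ∀ t ∈ S, ¬ (s < t ∧ t < x) := by
      by_cases hne : (S.filter (· < x)).Nonempty
      · have hmem := Finset.max'_mem _ hne
        set s := (S.filter (· < x)).max' hne with hsdef
        have hm := Finset.mem_filter.1 hmem
        refine ⟨s, hm.2.le, hS s hm.1, (ih _ ?_ s rfl).2 (hS s hm.1), ?_⟩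
        · apply Finset.card_lt_card
          refine ⟨fun t ht => ?_, fun h => ?_⟩
          · rw [Finset.mem_filter] at ht ⊢
            exact ⟨ht.1, ht.2.trans hm.2⟩
          · exact lt_irrefl _ (Finset.mem_filter.1 (h hmem)).2
        · rintro t ht ⟨h1, h2⟩
          exact absurd (Finset.le_max' _ t (Finset.mem_filter.2 ⟨ht, h2⟩)) (not_le.2 h1)
      · refine ⟨0, unitInterval.nonneg', by simpa using isDyadic_zero,
          by rw [map_zero']; simpa using isDyadic_zero, ?_⟩
        rintro t ht ⟨-, h2⟩
        exact hne ⟨t, Finset.mem_filter.2 ⟨ht, h2⟩⟩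
    obtain ⟨k, c, h⟩ := hA s x hsx hno
    have h1 := h s le_rfl hsx
    have h2 := h x hsx le_rfl
    constructor
    · intro hx
      have : (x : ℝ) = s + 2 ^ (-k) * ((f x : ℝ) - f s) := by
        rw [h1, h2, zpow_neg]
        field_simp
        ring
      rw [this]
      exact hs.add ((hx.sub hfs).zpow_mul _)
    · intro hx
      have : (f x : ℝ) = f s + 2 ^ k * ((x : ℝ) - s) := by
        rw [h1, h2]
        ring
      rw [this]
      exact hfs.add ((hx.sub hs).zpow_mul _)

theorem IsDyadicPL.one : IsDyadicPL 1 :=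
  ⟨∅, by simp, fun a b _ _ => ⟨0, 0, fun x _ _ => by simp⟩⟩

theorem IsDyadicPL.inv {f : unitInterval ≃o unitInterval} (hf : IsDyadicPL f) :
    IsDyadicPL f⁻¹ := by
  obtain ⟨S, hS, hA⟩ := id hf
  have key : ∀ x, f (f⁻¹ x) = x := fun x => f.apply_symm_apply x
  have mono : ∀ x y, f⁻¹ x ≤ f⁻¹ y ↔ x ≤ y := fun x y => f.symm.le_iff_le
  refine ⟨S.image f, ?_, fun a b hab hno => ?_⟩
  · intro s hs
    obtain ⟨t, ht, rfl⟩ := Finset.mem_image.1 hs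
    exact (hf.isDyadic_iff t).2 (hS t ht)
  · obtain ⟨k, c, h⟩ := hA (f⁻¹ a) (f⁻¹ b) ((mono a b).2 hab) (fun s hs hs' => by
      refine hno (f s) (Finset.mem_image_of_mem f hs) ⟨?_, ?_⟩
      · rw [← key a]; exact f.lt_iff_lt.2 hs'.1
      · rw [← key b]; exact f.lt_iff_lt.2 hs'.2)
    refine ⟨-k, -(2 ^ (-k) * c), fun x hax hxb => ?_⟩
    have := h (f⁻¹ x) ((mono a x).2 hax) ((mono x b).2 hxb)
    rw [key] at this
    rw [this, zpow_neg]
    field_simp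
    ring

theorem IsDyadicPL.mul {f g : unitInterval ≃o unitInterval} (hf : IsDyadicPL f)
    (hg : IsDyadicPL g) : IsDyadicPL (f * g) := by
  obtain ⟨S, hS, hA⟩ := id hf
  obtain ⟨T, hT, hB⟩ := id hg
  have key : ∀ x, g (g⁻¹ x) = x := fun x => g.apply_symm_apply x
  refine ⟨T ∪ S.image (g⁻¹ : unitInterval ≃o unitInterval), ?_, fun a b hab hno => ?_⟩
  · intro s hs
    rcases Finset.mem_union.1 hs with hs | hs
    · exact hT s hs
    · obtain ⟨t, ht, rfl⟩ := Finset.mem_image.1 hs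
      exact (hg.inv.isDyadic_iff t).2 (hS t ht)
  · obtain ⟨k, c, h⟩ := hB a b hab fun s hs => hno s (Finset.mem_union_left _ hs)
    obtain ⟨l, d, h'⟩ := hA (g a) (g b) (g.le_iff_le.2 hab) (fun s hs hs' => by
      refine hno (g⁻¹ s) (Finset.mem_union_right _ (Finset.mem_image_of_mem _ hs)) ⟨?_, ?_⟩
      · rw [← g.lt_iff_lt, key]; exact hs'.1
      · rw [← g.lt_iff_lt, key]; exact hs'.2)
    refine ⟨l + k, 2 ^ l * c + d, fun x hax hxb => ?_⟩
    have e : (f * g) x = f (g x) := rfl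
    rw [e, h' (g x) (g.le_iff_le.2 hax) (g.le_iff_le.2 hxb), h x hax hxb,
      zpow_add₀ (by norm_num)]
    ring

/-- Thompson's group `F`, as a group of homeomorphisms of `[0, 1]` under composition. -/
def F : Subgroup (unitInterval ≃o unitInterval) where
  carrier := {f | IsDyadicPL f}
  one_mem' := IsDyadicPL.one
  mul_mem' := IsDyadicPL.mul
  inv_mem' := IsDyadicPL.inv

/-- The formula for `x_n`, where `l = 2⁻ⁿ`. -/
def xFun (l t : ℝ) : ℝ :=
  if t ≤ 1 - l then t
  else if t ≤ 1 - l / 2 then t / 2 + (1 - l) / 2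
  else if t ≤ 1 - l / 4 then t - l / 4
  else 2 * t - 1

/-- The formula for the inverse of `x_n`, where `l = 2⁻ⁿ`. -/
def xInv (l t : ℝ) : ℝ :=
  if t ≤ 1 - l then t
  else if t ≤ 1 - 3 * l / 4 then 2 * t - (1 - l)
  else if t ≤ 1 - l / 2 then t + l / 4
  else (t + 1) / 2

theorem xInv_xFun {l : ℝ} (hl : 0 < l) (t : ℝ) : xInv l (xFun l t) = t := by
  unfold xInv xFun
  split_ifs <;> linarith

theorem xFun_xInv {l : ℝ} (hl : 0 < l) (t : ℝ) : xFun l (xInv l t) = t := by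
  unfold xInv xFun
  split_ifs <;> linarith

theorem xFun_mem {l : ℝ} (hl : 0 < l) (hl1 : l ≤ 1) (t : unitInterval) :
    xFun l t ∈ unitInterval := by
  have h0 := t.2.1
  have h1 := t.2.2
  unfold xFun
  split_ifs <;> constructor <;> linarith

theorem xInv_mem {l : ℝ} (hl : 0 < l) (hl1 : l ≤ 1) (t : unitInterval) :
    xInv l t ∈ unitInterval := by
  have h0 := t.2.1
  have h1 := t.2.2
  unfold xInv
  split_ifs <;> constructor <;> linarith

theorem xFun_strictMono {l : ℝ} (hl : 0 < l) : StrictMono (xFun l) := by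
  intro s t hst
  unfold xFun
  split_ifs <;> linarith

theorem pow_pos' (n : ℕ) : (0 : ℝ) < (1 / 2) ^ n := by positivity

theorem pow_le_one'' (n : ℕ) : ((1 : ℝ) / 2) ^ n ≤ 1 :=
  pow_le_one₀ (by norm_num) (by norm_num)

/-- `x_n` as an increasing bijection of `[0, 1]`. -/
def xIso (n : ℕ) : unitInterval ≃o unitInterval :=
  StrictMono.orderIsoOfRightInverse
    (fun t => ⟨xFun ((1 / 2) ^ n) t, xFun_mem (pow_pos' n) (pow_le_one'' n) t⟩)
    (fun _ _ h => xFun_strictMono (pow_pos' n) h)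
    (fun t => ⟨xInv ((1 / 2) ^ n) t, xInv_mem (pow_pos' n) (pow_le_one'' n) t⟩)
    (fun t => Subtype.ext (xFun_xInv (pow_pos' n) t))

theorem xIso_apply (n : ℕ) (t : unitInterval) : (xIso n t : ℝ) = xFun ((1 / 2) ^ n) t := rfl

theorem isDyadic_half_pow (n : ℕ) : IsDyadic ((1 / 2) ^ n) := ⟨1, n, by simp⟩

theorem xIso_mem (n : ℕ) : xIso n ∈ F := by
  have hl := pow_pos' n
  have hl1 := pow_le_one'' n
  have d1 : IsDyadic (1 - (1 / 2) ^ n) := isDyadic_one.sub (isDyadic_half_pow n)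
  have d2 : IsDyadic (1 - (1 / 2) ^ n / 2) := by
    have := isDyadic_one.sub (isDyadic_half_pow (n + 1))
    rwa [pow_succ, mul_one_div] at this
  have d3 : IsDyadic (1 - (1 / 2) ^ n / 4) := by
    have := isDyadic_one.sub (isDyadic_half_pow (n + 2))
    have e : ((1 : ℝ) / 2) ^ (n + 2) = (1 / 2) ^ n / 4 := by rw [pow_add]; norm_num; ring
    rwa [e] at this
  set l : ℝ := (1 / 2) ^ n with hldef
  let p1 : unitInterval := ⟨1 - l, by constructor <;> linarith⟩
  let p2 : unitInterval := ⟨1 - l / 2, by constructor <;> linarith⟩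
  let p3 : unitInterval := ⟨1 - l / 4, by constructor <;> linarith⟩
  refine ⟨{p1, p2, p3}, ?_, fun a b hab hno => ?_⟩
  · intro s hs
    simp only [Finset.mem_insert, Finset.mem_singleton] at hs
    rcases hs with rfl | rfl | rfl
    · exact d1
    · exact d2
    · exact d3
  · have n1 : ¬ ((a : ℝ) < 1 - l ∧ 1 - l < (b : ℝ)) := hno p1 (by simp)
    have n2 : ¬ ((a : ℝ) < 1 - l / 2 ∧ 1 - l / 2 < (b : ℝ)) := hno p2 (by simp)
    have n3 : ¬ ((a : ℝ) < 1 - l / 4 ∧ 1 - l / 4 < (b : ℝ)) := hno p3 (by simp)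
    have main : ∀ (k : ℤ) (c : ℝ),
        (∀ x : ℝ, (a : ℝ) ≤ x → x ≤ b → xFun l x = 2 ^ k * x + c) →
        ∃ (k : ℤ) (c : ℝ), ∀ x, a ≤ x → x ≤ b → (xIso n x : ℝ) = 2 ^ k * (x : ℝ) + c :=
      fun k c h => ⟨k, c, fun x hx hx' => by rw [xIso_apply]; exact h x hx hx'⟩
    by_cases c1 : (b : ℝ) ≤ 1 - l
    · refine main 0 0 fun x h1 h2 => ?_
      rw [zpow_zero]
      unfold xFun
      split_ifs <;> linarith
    have c1' : 1 - l ≤ (a : ℝ) := by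
      by_contra h
      exact n1 ⟨not_le.1 h, not_le.1 c1⟩
    by_cases c2 : (b : ℝ) ≤ 1 - l / 2
    · refine main (-1) ((1 - l) / 2) fun x h1 h2 => ?_
      rw [zpow_neg_one]
      unfold xFun
      split_ifs <;> linarith
    have c2' : 1 - l / 2 ≤ (a : ℝ) := by
      by_contra h
      exact n2 ⟨not_le.1 h, not_le.1 c2⟩
    by_cases c3 : (b : ℝ) ≤ 1 - l / 4
    · refine main 0 (-(l / 4)) fun x h1 h2 => ?_
      rw [zpow_zero]
      unfold xFun
      split_ifs <;> linarith
    have c3' : 1 - l / 4 ≤ (a : ℝ) := by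
      by_contra h
      exact n3 ⟨not_le.1 h, not_le.1 c3⟩
    refine main 1 (-1) fun x h1 h2 => ?_
    rw [zpow_one]
    unfold xFun
    split_ifs <;> linarith

/-- The standard generators `x_n` of `F`:
`x_n(t) = t` on `[0, 1 - 2⁻ⁿ]`, `t/2 + (1 - 2⁻ⁿ)/2` on `[1 - 2⁻ⁿ, 1 - 2⁻ⁿ⁻¹]`,
`t - 2⁻ⁿ⁻²` on `[1 - 2⁻ⁿ⁻¹, 1 - 2⁻ⁿ⁻²]` and `2 t - 1` on `[1 - 2⁻ⁿ⁻², 1]`. -/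
def x (n : ℕ) : F := ⟨xIso n, xIso_mem n⟩

end Thompson

/-! ### The first Grigorchuk group -/

namespace Grigorchuk

/-- The boundary of the infinite rooted binary tree: infinite branches, as infinite sequences
of binary digits. -/
abbrev Boundary := ℕ → Bool

/-- The states of the automaton that defines the group. -/
inductive State
  | one | a | b | c | d

/-- The section of a state at the vertices `0 = false` and `1 = true` of the first level:
`a = (1, 1)σ` with `σ` the switch of the two subtrees, `b = (a, c)`, `c = (a, d)`,
`d = (1, b)`. -/
def State.next : State → Bool → State
  | .one, _ => .one
  | .a, _ => .one
  | .b, false => .a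
  | .b, true => .c
  | .c, false => .a
  | .c, true => .d
  | .d, false => .one
  | .d, true => .b

/-- The action on the first digit: only `a` changes it. -/
def State.out : State → Bool → Bool
  | .a, e => !e
  | .one, e => e
  | .b, e => e
  | .c, e => e
  | .d, e => e

/-- The action of a state `s` on the boundary:
`s (ξ_0 ξ_1 ξ_2 …) = (s.out ξ_0) ((s.next ξ_0) (ξ_1 ξ_2 …))`. -/
def act : State → Boundary → Boundary
  | s, ξ, 0 => s.out (ξ 0)
  | s, ξ, n + 1 => act (s.next (ξ 0)) (fun i => ξ (i + 1)) n

theorem act_act (s : State) (ξ : Boundary) : act s (act s ξ) = ξ := by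
  funext n
  induction n generalizing s ξ with
  | zero => cases s <;> simp [act, State.out]
  | succ n ih =>
    have h1 : act s (act s ξ) (n + 1) =
        act (s.next (s.out (ξ 0))) (act (s.next (ξ 0)) (fun i => ξ (i + 1))) n := rfl
    have h2 : s.next (s.out (ξ 0)) = s.next (ξ 0) := by
      cases s <;> rfl
    rw [h1, h2, ih]

/-- The permutation of the boundary given by a state. -/
def perm (s : State) : Equiv.Perm Boundary where
  toFun := act s
  invFun := act s
  left_inv := act_act s
  right_inv := act_act s

/-- The first Grigorchuk group, generated by `a`, `b`, `c`, `d`. -/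
def Γ : Subgroup (Equiv.Perm Boundary) :=
  Subgroup.closure {perm .a, perm .b, perm .c, perm .d}

/-- The standard generator `a`. -/
def a : Γ := ⟨perm .a, Subgroup.subset_closure (by simp)⟩

/-- The standard generator `b`. -/
def b : Γ := ⟨perm .b, Subgroup.subset_closure (by simp)⟩

/-- The standard generator `c`. -/
def c : Γ := ⟨perm .c, Subgroup.subset_closure (by simp)⟩

/-- The standard generator `d`. -/
def d : Γ := ⟨perm .d, Subgroup.subset_closure (by simp)⟩

end Grigorchuk

end

/-! Inside `𝔽_m ∗ G` the tuple of free generators gives every word itself as its value, and a word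
with a non-trivial value in `G` is non-trivial. As `G` is finitely generated, `W` is countable, so
it is enough that any finitely many words of the three kinds take non-trivial values at one common
tuple `h` (`exists_eval_ne_one`); `g n` then serves the first `n + 1` words.

The tuple is taken in a small member `S n` of a decreasing sequence of subgroups tending to the
identity. For small `h`, the point `w(h) x` is close to the product of constants applied to `x`,
which settles words with non-trivial product. An oscillating word has a point `p` whose trajectory
under the constants is moved by each constant, and this persists for small `h` and points `x` near
`p`. The variables are then adjusted one letter at a time inside `S n`: each time, compose with an
element fixing the finitely many points already prescribed and moving the current one to a fresh
place. The trajectory of `x` never closes up (`exists_run_notMem`). The finitely many prescribed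
values are kept for the words that follow. For an almost oscillating `w`, constants acting trivially
near `p` can be deleted there, so `w(h) = 1` forces `w_V(h)` to fix all points near `p`, and `w_V`
is handled as before.

It remains to find such subgroups (`IsSeparatingFiltration`). For `F` they are the stabilizers of
dyadic grids, with copies of `x_0` on small dyadic intervals as separating elements. For `Γ` they
are the level stabilizers; the separating elements come from the branching of the normal closure `K`
of `(ab)²`. That `x_0, x_1` generate `F` is proved with dyadic partitions: every partition is the
image of a vine under an element of `⟨x_0, x_1⟩`. -/

noncomputable section

/-! ### Following a point along a word -/

namespace WordLimit

open Monoid Set Filter Topology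

section Trajectories

variable {m : ℕ} {G : Type*} [Group G] {X : Type*} [MulAction G X]

/-- A letter of a word: a variable or its inverse, or a constant. -/
abbrev Letter (m : ℕ) (G : Type*) := (Fin m × Bool) ⊕ G

/-- The value of a letter. -/
def letterVal (h : Fin m → G) : Letter m G → G
  | .inl l => bif l.2 then h l.1 else (h l.1)⁻¹
  | .inr v => v

/-- The end of the trajectory of `t` under the letters of a list, applied from left to right. -/
def run (h : Fin m → G) : List (Letter m G) → X → X
  | [], t => t
  | l :: R, t => run h R (letterVal h l • t)

/-- Every constant on the list moves the point of the trajectory that it is applied to. -/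
def Moves (h : Fin m → G) : List (Letter m G) → X → Prop
  | [], _ => True
  | .inl l :: R, t => Moves h R (letterVal h (.inl l) • t)
  | .inr v :: R, t => v • t ≠ t ∧ Moves h R (v • t)

/-- Neighbouring letters do not cancel, and no two constants are neighbours. -/
def Compat : Letter m G → Letter m G → Prop
  | .inl l, .inl l' => l.1 = l'.1 → l.2 = l'.2
  | .inr _, .inr _ => False
  | _, _ => True

/-- The tuples `h` and `h'` take the same values at the arguments listed in `C`. -/
def Agree (C : Set (Fin m × X)) (h h' : Fin m → G) : Prop :=
  ∀ e ∈ C, h' e.1 • e.2 = h e.1 • e.2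

/-- The argument of `h l.1` that is used when the letter `l` is applied to `t`. -/
def edge (h : Fin m → G) (l : Fin m × Bool) (t : X) : Fin m × X :=
  (l.1, bif l.2 then t else (h l.1)⁻¹ • t)

/-- The arguments and values prescribed by `C`. -/
def points (h : Fin m → G) (C : Set (Fin m × X)) : Set X :=
  Prod.snd '' C ∪ (fun e => h e.1 • e.2) '' C

/-- The next letter can be applied to `t` without using a value prescribed by `C`. -/
def Ready (h : Fin m → G) (C : Set (Fin m × X)) (A : Set X) (t : X) : List (Letter m G) → Prop
  | [] => t ∉ A
  | .inl l :: _ => edge h l t ∉ C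
  | .inr v :: _ => v • t ∉ points h C ∪ A

theorem Agree.refl (C : Set (Fin m × X)) (h : Fin m → G) : Agree C h h := fun _ _ => rfl

theorem Agree.trans {C : Set (Fin m × X)} {h₁ h₂ h₃ : Fin m → G} (h : Agree C h₁ h₂)
    (h' : Agree C h₂ h₃) : Agree C h₁ h₃ := fun e he => (h' e he).trans (h e he)

theorem Agree.mono {C C' : Set (Fin m × X)} {h₁ h₂ : Fin m → G} (h : Agree C' h₁ h₂)
    (hC : C ⊆ C') : Agree C h₁ h₂ := fun e he => h e (hC he)

theorem points_finite (h : Fin m → G) {C : Set (Fin m × X)} (hC : C.Finite) :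
    (points h C).Finite := (hC.image _).union (hC.image _)

theorem Agree.points_eq {C : Set (Fin m × X)} {h h' : Fin m → G} (hh : Agree C h h') :
    points h' C = points h C := by
  unfold points
  congr 1
  exact image_congr hh

theorem edge_notMem_of_notMem_points {h : Fin m → G} {C : Set (Fin m × X)} {t : X}
    (ht : t ∉ points h C) (l : Fin m × Bool) : edge h l t ∉ C := by
  obtain ⟨i, b⟩ := l
  intro hm
  apply ht
  cases b
  · exact Or.inr ⟨_, hm, by simp [edge]⟩
  · exact Or.inl ⟨_, hm, rfl⟩

theorem Agree.letterVal_smul {C : Set (Fin m × X)} {h h' : Fin m → G} {l : Fin m × Bool} {t : X}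
    (hh : Agree C h h') (hl : edge h l t ∈ C) :
    letterVal h' (.inl l) • t = letterVal h (.inl l) • t := by
  obtain ⟨i, b⟩ := l
  have := hh _ hl
  cases b
  · simp only [edge, cond_false, smul_inv_smul] at this
    simp only [letterVal, cond_false]
    rw [inv_smul_eq_iff, this]
  · exact this

variable {S : Subgroup G} {X' : Set X}

/-- Let `g` also fix `A \ {x}`. If `g x` were in `A`, it would be a fixed point of `g` different
from `x`, against injectivity. -/
theorem exists_smul_notMem
    (hsep : ∀ Y : Set X, Y.Finite → ∀ x ∈ X', x ∉ Y → ∃ g ∈ S, (∀ y ∈ Y, g • y = y) ∧ g • x ≠ x)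
    {Y A : Set X} (hY : Y.Finite) (hA : A.Finite) {x : X} (hx : x ∈ X') (hxY : x ∉ Y) :
    ∃ g ∈ S, (∀ y ∈ Y, g • y = y) ∧ g • x ∉ A := by
  obtain ⟨g, hg, hfix, hne⟩ := hsep (Y ∪ (A \ {x})) (hY.union hA.sdiff) x hx (by simp [hxY])
  refine ⟨g, hg, fun y hy => hfix y (Or.inl hy), fun hgA => hne ?_⟩
  have := hfix (g • x) (Or.inr ⟨hgA, hne⟩)
  exact smul_left_cancel g this

/-- Only the entry `h i` changes. For a positive letter it becomes `g * h i` with `g` fixing the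
prescribed values; for an inverse letter it becomes `h i * g⁻¹` with `g` fixing the prescribed
arguments. -/
theorem exists_agree_letterVal_smul_notMem (hinv : ∀ (g : G), ∀ x ∈ X', g • x ∈ X')
    (hsep : ∀ Y : Set X, Y.Finite → ∀ x ∈ X', x ∉ Y → ∃ g ∈ S, (∀ y ∈ Y, g • y = y) ∧ g • x ≠ x)
    {h : Fin m → G} (hh : ∀ i, h i ∈ S) {C : Set (Fin m × X)} (hC : C.Finite) {t : X}
    (ht : t ∈ X') {l : Fin m × Bool} (hl : edge h l t ∉ C) {A : Set X} (hA : A.Finite) :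
    ∃ h' : Fin m → G, (∀ i, h' i ∈ S) ∧ Agree C h h' ∧ letterVal h' (.inl l) • t ∉ A := by
  obtain ⟨i, b⟩ := l
  have mem : ∀ k ∈ S, ∀ j, Function.update h i k j ∈ S := by
    intro k hk j
    by_cases hj : j = i
    · subst hj; simpa using hk
    · simpa [Function.update_of_ne hj] using hh j
  cases b
  · obtain ⟨g, hg, hfix, hne⟩ := exists_smul_notMem hsep
      (Y := Prod.snd '' (C ∩ {e | e.1 = i})) ((hC.inter_of_left _).image _) hA
      (hinv (h i)⁻¹ t ht) (by
        rintro ⟨⟨j, s⟩, ⟨hm, rfl : j = i⟩, hs⟩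
        apply hl
        simpa [edge, ← hs] using hm)
    refine ⟨Function.update h i (h i * g⁻¹), mem _ (S.mul_mem (hh i) (S.inv_mem hg)), ?_, ?_⟩
    · rintro ⟨j, s⟩ hm
      by_cases hj : j = i
      · subst hj
        have := hfix s ⟨_, ⟨hm, rfl⟩, rfl⟩
        simp only [Function.update_self, mul_smul]
        rw [inv_smul_eq_iff.2 this.symm]
      · simp [Function.update_of_ne hj]
    · simpa [letterVal, mul_smul] using hne
  · obtain ⟨g, hg, hfix, hne⟩ := exists_smul_notMem hsep
      (Y := (fun e => h i • e.2) '' (C ∩ {e | e.1 = i})) ((hC.inter_of_left _).image _) hA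
      (hinv (h i) t ht) (by
        rintro ⟨⟨j, s⟩, ⟨hm, rfl : j = i⟩, hs⟩
        apply hl
        have hs : s = t := smul_left_cancel _ hs
        simpa [edge, ← hs] using hm)
    refine ⟨Function.update h i (g * h i), mem _ (S.mul_mem hg (hh i)), ?_, ?_⟩
    · rintro ⟨j, s⟩ hm
      by_cases hj : j = i
      · subst hj
        have := hfix (h j • s) ⟨_, ⟨hm, rfl⟩, rfl⟩
        simpa [Function.update_self, mul_smul] using this
      · simp [Function.update_of_ne hj]
    · simpa [letterVal, mul_smul] using hne

/-- The constant with which a list of letters starts, if there is one. -/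
def headConst : List (Letter m G) → G
  | .inr v :: _ => v
  | _ => 1

/-- Each variable sends the current point to a fresh one, and the value used is then added to `C`.
The final `C'` freezes the whole trajectory, so that later changes for other words cannot destroy
it. -/
theorem exists_run_notMem (hinv : ∀ (g : G), ∀ x ∈ X', g • x ∈ X')
    (hsep : ∀ Y : Set X, Y.Finite → ∀ x ∈ X', x ∉ Y → ∃ g ∈ S, (∀ y ∈ Y, g • y = y) ∧ g • x ≠ x)
    {R : List (Letter m G)} (hR : R.IsChain Compat) {A : Set X} (hA : A.Finite)
    {h : Fin m → G} (hh : ∀ i, h i ∈ S) {C : Set (Fin m × X)} (hC : C.Finite) {t : X}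
    (ht : t ∈ X') (hready : Ready h C A t R)
    (hmoves : ∀ h' : Fin m → G, (∀ i, h' i ∈ S) → Agree C h h' → Moves h' R t) :
    ∃ h' : Fin m → G, (∀ i, h' i ∈ S) ∧ Agree C h h' ∧ ∃ C' : Set (Fin m × X), C'.Finite ∧
      C ⊆ C' ∧ run h' R t ∉ A ∧ ∀ h'', Agree C' h' h'' → run h'' R t = run h' R t := by
  induction R generalizing h C t with
  | nil => exact ⟨h, hh, Agree.refl _ _, C, hC, subset_rfl, hready, fun _ _ => rfl⟩
  | cons l R ih =>
    have hR' := hR.tail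
    rcases l with l | v
    · set B : Set X := points h C ∪ {t} ∪ A with hB
      have hBf : B.Finite := ((points_finite h hC).union (finite_singleton t)).union hA
      -- The new point and its image under a constant that may follow must both avoid `B`; hence the
      -- translate by `(headConst R)⁻¹`.
      obtain ⟨h₁, hh₁, hag, hnot⟩ := exists_agree_letterVal_smul_notMem hinv hsep hh hC ht hready
        (hBf.union (hBf.image fun x => (headConst R)⁻¹ • x))
      set t₁ := letterVal h₁ (.inl l) • t with ht₁
      have ht₁B : t₁ ∉ B := fun hx => hnot (Or.inl hx)
      have hvB : headConst R • t₁ ∉ B := fun hx => hnot (Or.inr ⟨_, hx, by simp⟩)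
      have hpts : points h₁ C = points h C := hag.points_eq
      have hmv : ∀ h' : Fin m → G, (∀ i, h' i ∈ S) → Agree (insert (edge h₁ l t) C) h₁ h' →
          Moves h' R t₁ := by
        intro h' hh' hag'
        have := hmoves h' hh' (hag.trans (hag'.mono (subset_insert _ _)))
        rwa [Moves, hag'.letterVal_smul (mem_insert _ _)] at this
      have hready₁ : Ready h₁ (insert (edge h₁ l t) C) A t₁ R := by
        rcases R with _ | ⟨l' | v, R⟩
        · exact fun hx => ht₁B (Or.inr hx)
        · intro hx
          -- Using the newly prescribed value again would need either the inverse letter, excluded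
          -- by reducedness, or `t₁ = t`.
          rcases mem_insert_iff.1 hx with hx | hx
          · have hne : t₁ ≠ t := fun h0 => ht₁B (Or.inl (Or.inr h0))
            have hcompat : l.1 = l'.1 → l.2 = l'.2 := (List.isChain_cons_cons.1 hR).1
            have h1 : l'.1 = l.1 := (Prod.ext_iff.1 hx).1
            have h2 := hcompat h1.symm
            have h3 := (Prod.ext_iff.1 hx).2
            apply hne
            simp only [edge, h1, ← h2] at h3
            cases hb : l.2 <;> simp only [hb, cond_false, cond_true] at h3
            · exact smul_left_cancel _ h3
            · exact h3
          · refine edge_notMem_of_notMem_points (fun hp => ?_) l' hx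
            rw [hpts] at hp
            exact ht₁B (Or.inl (Or.inl hp))
        · have hvt : v • t₁ ≠ t₁ := (hmv h₁ hh₁ (Agree.refl _ _)).1
          rintro (hx | hx)
          -- The new edge joins `t` and `t₁`; `v • t₁` avoids `t` by the choice of `t₁`, and avoids
          -- `t₁` because `v` moves it.
          · have : points h₁ (insert (edge h₁ l t) C) ⊆ points h C ∪ {t} ∪ {t₁} := by
              rw [← hpts]
              rintro _ (⟨e, rfl | he, rfl⟩ | ⟨e, rfl | he, rfl⟩)
              · rcases l with ⟨i, _ | _⟩ <;> simp [edge, ht₁, letterVal]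
              · exact Or.inl (Or.inl (Or.inl ⟨e, he, rfl⟩))
              · rcases l with ⟨i, _ | _⟩ <;> simp [edge, ht₁, letterVal]
              · exact Or.inl (Or.inl (Or.inr ⟨e, he, rfl⟩))
            rcases this hx with hx | hx
            · exact hvB (Or.inl hx)
            · exact hvt hx
          · exact hvB (Or.inr hx)
      obtain ⟨h₂, hh₂, hag₂, C₂, hC₂, hCC₂, hrun, hst⟩ := ih hR' hh₁ (hC.insert _)
        (hinv _ _ ht) hready₁ hmv
      have e2 : letterVal h₂ (.inl l) • t = t₁ := hag₂.letterVal_smul (mem_insert _ _)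
      refine ⟨h₂, hh₂, hag.trans (hag₂.mono (subset_insert _ _)), C₂, hC₂,
        (subset_insert _ _).trans hCC₂, ?_, fun h₃ hag₃ => ?_⟩
      · rwa [run, e2]
      · have e3 : letterVal h₃ (.inl l) • t = t₁ :=
          (hag₂.trans (hag₃.mono hCC₂)).letterVal_smul (mem_insert _ _)
        rw [run, run, e2, e3, hst h₃ hag₃]
    · have hready₁ : Ready h C A (v • t) R := by
        rcases R with _ | ⟨l' | v', R⟩
        · exact fun hx => hready (Or.inr hx)
        · exact edge_notMem_of_notMem_points (fun hx => hready (Or.inl hx)) l'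
        · exact ((List.isChain_cons_cons.1 hR).1 : False).elim
      exact ih hR' hh hC (hinv v t ht) hready₁ fun h' hh' hag => (hmoves h' hh' hag).2

end Trajectories

/-! ### Reduced forms as lists of letters -/

section Letters

variable {m : ℕ} {G : Type*} [Group G] {X : Type*} [MulAction G X]

/-- The letters of an element of the free group, from right to left. -/
def freeLetters (u : FreeGroup (Fin m)) : List (Letter m G) :=
  u.toWord.reverse.map Sum.inl

/-- The letters of `u_k v_k ⋯ u_1 v_1`, from right to left. -/
def letters : List (FreeGroup (Fin m) × G) → List (Letter m G)
  | [] => []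
  | (u, v) :: L => (.inr v :: freeLetters u) ++ letters L

theorem run_append (h : Fin m → G) (R R' : List (Letter m G)) (t : X) :
    run h (R ++ R') t = run h R' (run h R t) := by
  induction R generalizing t with
  | nil => rfl
  | cons l R ih => exact ih _

theorem run_freeLetters (h : Fin m → G) (u : FreeGroup (Fin m)) (t : X) :
    run h (freeLetters u) t = FreeGroup.lift h u • t := by
  conv_rhs => rw [← FreeGroup.mk_toWord (x := u), FreeGroup.lift_mk]
  unfold freeLetters
  induction u.toWord generalizing t with
  | nil => simp [run]
  | cons l L ih =>
    rw [List.reverse_cons, List.map_append, run_append, ih]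
    simp only [List.map_cons, List.map_nil, List.prod_cons, mul_smul]
    rfl

theorem run_letters (h : Fin m → G) (L : List (FreeGroup (Fin m) × G)) (t : X) :
    run h (letters L) t = eval (MonoidHom.id G) h (toWord L) • t := by
  induction L generalizing t with
  | nil => simp [run, letters, toWord]
  | cons p L ih =>
    obtain ⟨u, v⟩ := p
    rw [letters, run_append, ih, toWord, map_mul, map_mul, mul_smul, mul_smul]
    simp [eval, run, run_freeLetters, letterVal]

end Letters

section Chains

variable {m : ℕ} {G : Type*}

theorem isChain_freeLetters (u : FreeGroup (Fin m)) :
    (freeLetters u : List (Letter m G)).IsChain Compat := by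
  rw [freeLetters, List.isChain_map, List.isChain_reverse]
  exact (FreeGroup.isReduced_toWord (x := u)).imp fun a b hab h => (hab h.symm).symm

/-- Two constants never meet because a non-trivial `u_i` lies between them; only the last `u_k`,
with nothing after it, may be empty. -/
theorem isChain_letters {L : List (FreeGroup (Fin m) × G)} (hL : ∀ p ∈ L.dropLast, p.1 ≠ 1) :
    (letters L).IsChain Compat := by
  induction L with
  | nil => exact List.isChain_nil
  | cons p L ih =>
    obtain ⟨u, v⟩ := p
    have h1 : (.inr v :: freeLetters u : List (Letter m G)).IsChain Compat := by
      refine List.isChain_cons.2 ⟨?_, isChain_freeLetters u⟩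
      intro y hy
      have : y ∈ (freeLetters u : List (Letter m G)) := List.mem_of_mem_head? hy
      obtain ⟨l, -, rfl⟩ := List.mem_map.1 this
      trivial
    rcases L with _ | ⟨⟨u', v'⟩, L⟩
    · simpa [letters] using h1
    · rw [letters, List.isChain_append]
      refine ⟨h1, ih fun q hq => hL q ?_, ?_⟩
      · rw [List.dropLast_cons_cons]
        exact List.mem_cons_of_mem _ hq
      · have hu : u ≠ 1 := hL (u, v) (by simp)
        have hne : (freeLetters u : List (Letter m G)) ≠ [] := by
          simpa [freeLetters, FreeGroup.toWord_eq_nil_iff] using hu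
        intro a ha b hb
        rw [List.getLast?_cons_of_ne_nil hne] at ha
        obtain ⟨l, -, rfl⟩ := List.mem_map.1 (List.mem_of_mem_getLast? ha)
        have : b = .inr v' := by simpa [letters] using hb.symm
        subst this
        trivial

end Chains

end WordLimit

/-! ### Actions with a filtration by small subgroups -/

namespace WordLimit

open Monoid Set Filter Topology

theorem eventually_ne_of_tendsto {α Y : Type*} [TopologicalSpace Y] [T2Space Y] {l : Filter α}
    {f g : α → Y} {a b : Y} (hf : Tendsto f l (𝓝 a)) (hg : Tendsto g l (𝓝 b)) (hab : a ≠ b) :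
    ∀ᶠ z in l, f z ≠ g z :=
  (hf.prodMk_nhds hg).eventually (isClosed_diagonal.isOpen_compl.mem_nhds hab)

section Filtration

variable {m : ℕ} {G : Type*} [Group G] {X : Type*} [MulAction G X] [TopologicalSpace X]

/-- A decreasing sequence of subgroups `S n` whose elements are close to the identity for large `n`,
each of which acts on the dense invariant set `X'` in a separating way. -/
structure IsSeparatingFiltration (S : ℕ → Subgroup G) (X' : Set X) : Prop where
  antitone : Antitone S
  small : ∀ q : X, ∀ A ∈ 𝓝 q, ∃ n, ∃ B ∈ 𝓝 q, ∀ g ∈ S n, ∀ x ∈ B, g • x ∈ A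
  smul_mem : ∀ g : G, ∀ x ∈ X', g • x ∈ X'
  dense : Dense X'
  separating : ∀ n, ∀ Y : Set X, Y.Finite → ∀ x ∈ X', x ∉ Y →
    ∃ g ∈ S n, (∀ y ∈ Y, g • y = y) ∧ g • x ≠ x

/-- The filter of tuples close to the identity. -/
def smallTuples (S : ℕ → Subgroup G) (m : ℕ) : Filter (Fin m → G) :=
  ⨅ n, 𝓟 {h | ∀ i, h i ∈ S n}

theorem eval_inl (h : Fin m → G) (u : FreeGroup (Fin m)) :
    eval (MonoidHom.id G) h (Coprod.inl u) = FreeGroup.lift h u :=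
  Coprod.lift_apply_inl _ _ _

theorem eval_inr (h : Fin m → G) (v : G) : eval (MonoidHom.id G) h (Coprod.inr v) = v :=
  Coprod.lift_apply_inr _ _ _

/-! ### Words evaluated at small tuples -/

namespace IsSeparatingFiltration

variable {S : ℕ → Subgroup G} {X' : Set X} (hS : IsSeparatingFiltration S X')

include hS

theorem hasBasis : (smallTuples S m).HasBasis (fun _ => True) fun n => {h | ∀ i, h i ∈ S n} := by
  apply hasBasis_iInf_principal
  intro a b
  exact ⟨max a b, fun h hh i => hS.antitone (le_max_left a b) (hh i),
    fun h hh i => hS.antitone (le_max_right a b) (hh i)⟩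

theorem eventually_prod_iff {q : X} {P : (Fin m → G) × X → Prop} :
    (∀ᶠ z in smallTuples S m ×ˢ 𝓝 q, P z) ↔
      ∃ n, ∃ B ∈ 𝓝 q, ∀ h : Fin m → G, (∀ i, h i ∈ S n) → ∀ x ∈ B, P (h, x) := by
  constructor
  · intro h
    obtain ⟨A, hA, B, hB, hAB⟩ := Filter.mem_prod_iff.1 h
    obtain ⟨n, -, hn⟩ := hS.hasBasis.mem_iff.1 hA
    exact ⟨n, B, hB, fun h hh x hx => hAB ⟨hn hh, hx⟩⟩
  · rintro ⟨n, B, hB, h⟩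
    exact Filter.mem_prod_iff.2 ⟨_, hS.hasBasis.mem_of_mem (i := n) trivial, B, hB,
      fun z hz => h z.1 hz.1 z.2 hz.2⟩

theorem tendsto_letter (i : Fin m) (q : X) :
    Tendsto (fun z : (Fin m → G) × X => z.1 i • z.2) (smallTuples S m ×ˢ 𝓝 q) (𝓝 q) ∧
    Tendsto (fun z : (Fin m → G) × X => (z.1 i)⁻¹ • z.2) (smallTuples S m ×ˢ 𝓝 q) (𝓝 q) := by
  constructor <;> intro A hA <;> obtain ⟨n, B, hB, h⟩ := hS.small q A hA
  · exact hS.eventually_prod_iff.2 ⟨n, B, hB, fun g hg x hx => h _ (hg i) x hx⟩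
  · exact hS.eventually_prod_iff.2 ⟨n, B, hB, fun g hg x hx => h _ ((S n).inv_mem (hg i)) x hx⟩

theorem tendsto_lift (u : FreeGroup (Fin m)) (q : X) :
    Tendsto (fun z : (Fin m → G) × X => FreeGroup.lift z.1 u • z.2) (smallTuples S m ×ˢ 𝓝 q)
      (𝓝 q) := by
  induction u using FreeGroup.induction_on with
  | C1 => simpa using tendsto_snd
  | of i => simpa using (hS.tendsto_letter i q).1
  | inv_of i _ => simpa using (hS.tendsto_letter i q).2
  | mul a b ha hb =>
    simp only [map_mul, mul_smul]
    exact ha.comp (tendsto_fst.prodMk hb)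

/-- Small variables disappear in the limit, so only the constants survive. -/
theorem tendsto_eval [ContinuousConstSMul G X] (w : Word m G) (q : X) :
    Tendsto (fun z : (Fin m → G) × X => eval (MonoidHom.id G) z.1 w • z.2)
      (smallTuples S m ×ˢ 𝓝 q) (𝓝 ((Coprod.snd w : G) • q)) := by
  induction w using Coprod.induction_on generalizing q with
  | inl u => simpa [eval_inl] using hS.tendsto_lift u q
  | inr v =>
    simp only [eval_inr, Coprod.snd_apply_inr]
    exact ((continuous_const_smul v).tendsto q).comp tendsto_snd
  | mul a b ha hb =>
    simp only [map_mul, mul_smul]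
    exact (ha _).comp (tendsto_fst.prodMk (hb q))

theorem eventually_eval_ne_one [ContinuousConstSMul G X] [T2Space X] [FaithfulSMul G X]
    {w : Word m G} (hw : HasNontrivialProduct w) :
    ∃ n, ∀ h : Fin m → G, (∀ i, h i ∈ S n) → eval (MonoidHom.id G) h w ≠ 1 := by
  obtain ⟨q, hq⟩ : ∃ q : X, (Coprod.snd w : G) • q ≠ q := by
    by_contra! hcon
    exact hw (FaithfulSMul.eq_of_smul_eq_smul fun q : X => by rw [hcon q, one_smul])
  have h1 := hS.tendsto_eval w q
  have h2 : Tendsto (fun z : (Fin m → G) × X => z.2) (smallTuples S m ×ˢ 𝓝 q) (𝓝 q) :=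
    tendsto_snd
  obtain ⟨n, B, hB, h⟩ := hS.eventually_prod_iff.1 (eventually_ne_of_tendsto h1 h2 hq)
  refine ⟨n, fun g hg h0 => h g hg q (mem_of_mem_nhds hB) ?_⟩
  simp [h0]

/-- Near `p` a constant with exponent `0` acts as the identity, and small variables keep the
trajectory near that of `p` under the constants. -/
theorem eventually_deleteConstants [ContinuousConstSMul G X] [T2Space X]
    (L : List (FreeGroup (Fin m) × G)) (ε : List Bool) (hε : ε.length = L.length) {p : X}
    (hp : p ∈ cell L ε) :
    ∀ᶠ z in smallTuples S m ×ˢ 𝓝 p, eval (MonoidHom.id G) z.1 (toWord L) • z.2 =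
      eval (MonoidHom.id G) z.1 (toWord (deleteConstants L ε)) • z.2 := by
  induction L generalizing ε p with
  | nil => simp [deleteConstants]
  | cons a L ih =>
    obtain ⟨u, v⟩ := a
    obtain _ | ⟨e, ε⟩ := ε
    · simp at hε
    have hε' : ε.length = L.length := by simpa using hε
    have htend : Tendsto (fun z : (Fin m → G) × X => (z.1, FreeGroup.lift z.1 u • v • z.2))
        (smallTuples S m ×ˢ 𝓝 p) (smallTuples S m ×ˢ 𝓝 (v • p)) :=
      tendsto_fst.prodMk ((hS.tendsto_lift u (v • p)).comp
        (tendsto_fst.prodMk (((continuous_const_smul v).tendsto p).comp tendsto_snd)))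
    have hfix : ∀ᶠ z in smallTuples S m ×ˢ 𝓝 p, (if e then v else 1) • z.2 = v • z.2 := by
      cases e
      -- The interior is essential: `v` has to fix all points near `p`, not only `p`.
      · have h1 : interior (supp X v)ᶜ ∈ 𝓝 p := isOpen_interior.mem_nhds hp.1
        have : ∀ᶠ z in smallTuples S m ×ˢ 𝓝 p, z.2 ∈ interior (supp X v)ᶜ :=
          tendsto_snd.eventually h1
        filter_upwards [this] with z hz
        have := interior_subset hz
        simp only [supp, compl_compl, MulAction.mem_fixedBy] at this
        simp [this]
      · simp
    filter_upwards [htend.eventually (ih ε hε' hp.2), hfix] with z hz hz'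
    simp only [deleteConstants, List.zipWith_cons_cons, toWord, map_mul, mul_smul, eval_inl,
      eval_inr] at hz ⊢
    rw [hz']
    exact hz

/-- `u(h)⁻¹` is close to the identity, so it keeps points near `p` near `p`. -/
theorem eventually_conj (u : FreeGroup (Fin m)) (w : Word m G) {p : X} (E : (Fin m → G) → Prop)
    (h : ∀ᶠ z in smallTuples S m ×ˢ 𝓝 p,
      E z.1 → eval (MonoidHom.id G) z.1 w • z.2 = z.2) :
    ∀ᶠ z in smallTuples S m ×ˢ 𝓝 p,
      E z.1 → eval (MonoidHom.id G) z.1 (Coprod.inl u * w * (Coprod.inl u)⁻¹) • z.2 = z.2 := by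
  have ht : Tendsto (fun z : (Fin m → G) × X => (z.1, FreeGroup.lift z.1 u⁻¹ • z.2))
      (smallTuples S m ×ˢ 𝓝 p) (smallTuples S m ×ˢ 𝓝 p) :=
    tendsto_fst.prodMk (hS.tendsto_lift u⁻¹ p)
  filter_upwards [ht.eventually h] with z hz hE
  have := hz hE
  simp only [map_inv] at this
  rw [map_mul, map_mul, map_inv, eval_inl, mul_smul, mul_smul, this, smul_inv_smul]

/-- Assuming `w(h) = 1`, being fixed near `p` survives both the rotation and the deletion of
constants. The conditional form avoids keeping track of the successive conjugators. -/
theorem eventually_stage [ContinuousConstSMul G X] [T2Space X] {w w' : Word m G} {n : ℕ}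
    {V : Set X} (hst : Stage w n V w') {p : X} (hp : p ∈ V) :
    ∀ᶠ z in smallTuples S m ×ˢ 𝓝 p,
      eval (MonoidHom.id G) z.1 w = 1 → eval (MonoidHom.id G) z.1 w' • z.2 = z.2 := by
  induction hst with
  | zero => exact Eventually.of_forall fun z hz => by rw [hz, one_smul]
  | succ h hL hε hV ih =>
    obtain ⟨-, u, hu⟩ := hL
    have h1 := hS.eventually_conj u _ (fun h => eval (MonoidHom.id G) h _ = 1) (ih hp.1)
    rw [hu] at h1
    filter_upwards [h1, hS.eventually_deleteConstants _ _ hε hp.2] with z hz hz' h0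
    rw [← hz', hz h0]

/-- Being moved by a constant is an open condition in a Hausdorff space, and small variables hardly
change the trajectory. -/
theorem eventually_moves [ContinuousConstSMul G X] [T2Space X]
    (L : List (FreeGroup (Fin m) × G)) {p : X} (hp : p ∈ oscSet L) :
    ∀ᶠ z in smallTuples S m ×ˢ 𝓝 p, Moves z.1 (letters L) z.2 := by
  induction L generalizing p with
  | nil => simp [letters, Moves]
  | cons a L ih =>
    obtain ⟨u, v⟩ := a
    have ht₁ : Tendsto (fun z : (Fin m → G) × X => v • z.2) (smallTuples S m ×ˢ 𝓝 p)
        (𝓝 (v • p)) := ((continuous_const_smul v).tendsto p).comp tendsto_snd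
    have htend : Tendsto (fun z : (Fin m → G) × X => (z.1, FreeGroup.lift z.1 u • v • z.2))
        (smallTuples S m ×ˢ 𝓝 p) (smallTuples S m ×ˢ 𝓝 (v • p)) :=
      tendsto_fst.prodMk ((hS.tendsto_lift u (v • p)).comp (tendsto_fst.prodMk ht₁))
    have hne : ∀ᶠ z in smallTuples S m ×ˢ 𝓝 p, v • z.2 ≠ z.2 :=
      eventually_ne_of_tendsto ht₁ tendsto_snd hp.1
    filter_upwards [htend.eventually (ih hp.2), hne] with z hz hz'
    refine ⟨hz', ?_⟩
    have key : ∀ (R : List (Fin m × Bool)) (R' : List (Letter m G)) (t : X),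
        Moves z.1 (R.map Sum.inl ++ R') t ↔ Moves z.1 R' (run z.1 (R.map Sum.inl) t) := by
      intro R R'
      induction R with
      | nil => exact fun t => Iff.rfl
      | cons l R ihR => exact fun t => ihR _
    have := (key u.toWord.reverse (letters L) (v • z.2)).2
    refine this ?_
    change Moves z.1 (letters L) (run z.1 (freeLetters u) (v • z.2))
    rw [run_freeLetters]
    exact hz

/-- A word that is oscillating in a set of the splitting procedure is detected by the trajectory,
under a reduced list of letters, of any point near a suitable point `p`. -/
theorem exists_letters [ContinuousConstSMul G X] [T2Space X] [Nonempty X] {w w' : Word m G}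
    {n : ℕ} {V : Set X} (hst : Stage w n V w') (hw : IsOscillatingIn V w') :
    ∃ (R : List (Letter m G)) (p : X), R ≠ [] ∧ R.IsChain Compat ∧
      ∀ᶠ z in smallTuples S m ×ˢ 𝓝 p, Moves z.1 R z.2 ∧
        (eval (MonoidHom.id G) z.1 w = 1 → run z.1 R z.2 = z.2) := by
  obtain ⟨hne, ⟨u, rfl⟩ | ⟨L, hL, p, hpV, hpL⟩⟩ := hw
  · have hV : V.Nonempty := by
      generalize (Coprod.inl u : Word m G) = w' at hst
      cases hst with
      | zero => exact univ_nonempty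
      | succ _ _ _ hV => exact hV
    obtain ⟨p, hp⟩ := hV
    refine ⟨freeLetters u, p, ?_, isChain_freeLetters u, ?_⟩
    · have : u ≠ 1 := fun h => hne (by rw [h, map_one])
      simpa [freeLetters, FreeGroup.toWord_eq_nil_iff] using this
    · filter_upwards [hS.eventually_stage hst hp] with z hz
      refine ⟨?_, fun h0 => ?_⟩
      · have key : ∀ (R : List (Fin m × Bool)) (t : X),
            Moves z.1 (R.map Sum.inl : List (Letter m G)) t := by
          intro R
          induction R with
          | nil => exact fun t => trivial
          | cons l R ihR => exact fun t => ihR _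
        exact key _ _
      · rw [run_freeLetters, ← eval_inl, hz h0]
  · obtain ⟨⟨hLne, -, hL1⟩, u, hu⟩ := hL
    refine ⟨letters L, p, ?_, isChain_letters hL1, ?_⟩
    · obtain _ | ⟨a, L⟩ := L
      · exact absurd rfl hLne
      · simp [letters]
    · have h1 := hS.eventually_conj u _ (fun h => eval (MonoidHom.id G) h w = 1) (hS.eventually_stage hst hpV)
      rw [hu] at h1
      filter_upwards [h1, hS.eventually_moves L hpL] with z hz hz'
      exact ⟨hz', fun h0 => by rw [run_letters, hz h0]⟩

/-- Density gives a point of `X'` in `B`, possibly in `A`; a small element then pushes it off `A`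
without leaving `B`. -/
theorem exists_mem_notMem {p : X} {B : Set X} (hB : B ∈ 𝓝 p) {A : Set X} (hA : A.Finite) :
    ∃ x ∈ B, x ∈ X' ∧ x ∉ A := by
  obtain ⟨x, hxB, hx⟩ := hS.dense.inter_nhds_nonempty (interior_mem_nhds.2 hB)
  obtain ⟨n, U, hU, h⟩ := hS.small x B (mem_interior_iff_mem_nhds.1 hx)
  obtain ⟨g, hg, -, hgx⟩ := exists_smul_notMem (hS.separating n) finite_empty hA hxB (by simp)
  exact ⟨g • x, h g hg x (mem_of_mem_nhds hU), hS.smul_mem g x hxB, hgx⟩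

/-- The words are treated one after another. The threshold `n₀` comes before the tuple, so that `n`
can be fixed large enough for all words while the tuple is repeatedly changed inside `S n`. -/
theorem exists_agree_eval_ne_one [ContinuousConstSMul G X] [T2Space X] [Nonempty X]
    (ws : List (Word m G))
    (hws : ∀ w ∈ ws, ∃ n V w', Stage w n V w' ∧ IsOscillatingIn (V : Set X) w') :
    ∃ n₀, ∀ n ≥ n₀, ∃ h : Fin m → G, (∀ i, h i ∈ S n) ∧ ∃ C : Set (Fin m × X), C.Finite ∧
      ∀ h' : Fin m → G, (∀ i, h' i ∈ S n) → Agree C h h' →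
        ∀ w ∈ ws, eval (MonoidHom.id G) h' w ≠ 1 := by
  induction ws with
  | nil => exact ⟨0, fun n _ => ⟨1, fun i => (S n).one_mem, ∅, finite_empty, by simp⟩⟩
  | cons w ws ih =>
    obtain ⟨n₁, h₁⟩ := ih fun w' hw' => hws w' (List.mem_cons_of_mem _ hw')
    obtain ⟨k, V, w', hst, hosc⟩ := hws w List.mem_cons_self
    obtain ⟨R, p, hRne, hR, hev⟩ := hS.exists_letters hst hosc
    obtain ⟨n₂, B, hB, h₂⟩ := hS.eventually_prod_iff.1 hev
    refine ⟨max n₁ n₂, fun n hn => ?_⟩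
    obtain ⟨h, hh, C, hC, hCw⟩ := h₁ n ((le_max_left _ _).trans hn)
    have hle : S n ≤ S n₂ := hS.antitone ((le_max_right _ _).trans hn)
    have hP := points_finite h hC
    obtain ⟨x, hxB, hxX', hxA⟩ := hS.exists_mem_notMem hB
      (hP.union (hP.image fun y => (headConst R)⁻¹ • y))
    have hready : Ready h C {x} x R := by
      rcases R with _ | ⟨l | v, R⟩
      · exact absurd rfl hRne
      · exact edge_notMem_of_notMem_points (fun hx => hxA (Or.inl hx)) l
      · rintro (hx | hx)
        · exact hxA (Or.inr ⟨_, hx, by simp [headConst]⟩)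
        · exact (h₂ h (fun i => hle (hh i)) x hxB).1.1 hx
    -- With `A = {x}` the trajectory ends away from its start, which contradicts `w(h') = 1`.
    obtain ⟨h', hh', hag, C', hC', hCC', hrun, hstab⟩ := exists_run_notMem hS.smul_mem
      (hS.separating n) hR (finite_singleton x) hh hC hxX' hready
      fun h' hh' _ => (h₂ h' (fun i => hle (hh' i)) x hxB).1
    refine ⟨h', hh', C', hC', fun h'' hh'' hag'' w₀ hw₀ => ?_⟩
    rcases List.mem_cons.1 hw₀ with rfl | hw₀
    · intro h0
      apply hrun
      rw [← hstab h'' hag'']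
      exact (h₂ h'' (fun i => hle (hh'' i)) x hxB).2 h0
    · exact hCw h'' hh'' (hag.trans (hag''.mono hCC')) w₀ hw₀

theorem exists_eval_ne_one [ContinuousConstSMul G X] [T2Space X] [Nonempty X] [FaithfulSMul G X]
    (ws : List (Word m G))
    (hws : ∀ w ∈ ws, IsOscillating X w ∨ IsAlmostOscillating X w ∨ HasNontrivialProduct w) :
    ∃ h : Fin m → G, ∀ w ∈ ws, eval (MonoidHom.id G) h w ≠ 1 := by
  classical
  -- Words with non-trivial product are satisfied by every sufficiently small tuple, so they only
  -- raise the threshold.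
  have hprod : ∀ vs : List (Word m G), (∀ w ∈ vs, HasNontrivialProduct w) → ∃ n₀, ∀ n ≥ n₀,
      ∀ h : Fin m → G, (∀ i, h i ∈ S n) → ∀ w ∈ vs, eval (MonoidHom.id G) h w ≠ 1 := by
    intro vs hvs
    induction vs with
    | nil => simp
    | cons v vs ih =>
      obtain ⟨n₁, h₁⟩ := ih fun w hw => hvs w (List.mem_cons_of_mem _ hw)
      obtain ⟨n₂, h₂⟩ := hS.eventually_eval_ne_one (hvs v List.mem_cons_self)
      refine ⟨max n₁ n₂, fun n hn h hh w hw => ?_⟩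
      rcases List.mem_cons.1 hw with rfl | hw
      · exact h₂ h fun i => hS.antitone ((le_max_right _ _).trans hn) (hh i)
      · exact h₁ n ((le_max_left _ _).trans hn) h hh w hw
  obtain ⟨n₁, h₁⟩ := hprod (ws.filter fun w => HasNontrivialProduct w) (by simp)
  obtain ⟨n₂, h₂⟩ := hS.exists_agree_eval_ne_one (ws.filter fun w => ¬ HasNontrivialProduct w) (by
    intro w hw
    simp only [decide_not, List.mem_filter, Bool.not_eq_eq_eq_not, Bool.not_true,
      decide_eq_false_iff_not] at hw
    rcases hws w hw.1 with h | h | h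
    -- An oscillating word is the case of stage `0`.
    · exact ⟨0, univ, w, Stage.zero, h⟩
    · exact h.2
    · exact absurd h hw.2)
  obtain ⟨h, hh, C, -, hC⟩ := h₂ (max n₁ n₂) (le_max_right _ _)
  refine ⟨h, fun w hw => ?_⟩
  by_cases hp : HasNontrivialProduct w
  · exact h₁ _ (le_max_left _ _) h hh w (by simp [hw, hp])
  · exact hC h hh (Agree.refl _ _) w (by simp [hw, hp])

end IsSeparatingFiltration

/-! ### From finitely many words to a limit -/

theorem eval_inr_inl_of (w : Word m G) :
    eval (Coprod.inr : G →* Coprod (FreeGroup (Fin m)) G)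
      (fun i => Coprod.inl (FreeGroup.of i)) w = w := by
  have : eval (Coprod.inr : G →* Coprod (FreeGroup (Fin m)) G)
      (fun i => Coprod.inl (FreeGroup.of i)) = MonoidHom.id _ := by
    unfold eval
    apply Coprod.hom_ext
    · rw [Coprod.lift_comp_inl]
      ext i
      simp
    · rw [Coprod.lift_comp_inr]
      rfl
  rw [this, MonoidHom.id_apply]

instance countable_word [Countable G] : Countable (Word m G) := by
  have : Countable (FreeMonoid (FreeGroup (Fin m) ⊕ G)) :=
    inferInstanceAs (Countable (List (FreeGroup (Fin m) ⊕ G)))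
  exact Coprod.mk_surjective.countable

theorem countable_of_closure_eq_top {n : ℕ} {f : Fin n → G}
    (hf : Subgroup.closure (range f) = ⊤) : Countable G := by
  rw [← FreeGroup.range_lift_eq_closure, MonoidHom.range_eq_top] at hf
  exact hf.countable

theorem IsSeparatingFiltration.exists_isWLimit [ContinuousConstSMul G X] [T2Space X] [Nonempty X]
    [FaithfulSMul G X] [Countable G] {S : ℕ → Subgroup G} {X' : Set X}
    (hS : IsSeparatingFiltration S X') (W : Set (Word m G))
    (hW : ∀ w ∈ W, IsOscillating X w ∨ IsAlmostOscillating X w ∨ HasNontrivialProduct w) :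
    ∃ g : ℕ → Fin m → G, IsWLimit W (fun _ => MonoidHom.id G) g
      (Coprod.inr : G →* Coprod (FreeGroup (Fin m)) G)
      (fun i => Coprod.inl (FreeGroup.of i)) := by
  obtain rfl | hne := W.eq_empty_or_nonempty
  · exact ⟨fun _ _ => 1, fun w hw => absurd hw (notMem_empty w)⟩
  obtain ⟨f, rfl⟩ := W.to_countable.exists_eq_range hne
  choose g hg using fun n : ℕ => hS.exists_eval_ne_one ((List.range (n + 1)).map f) (by
    intro w hw
    obtain ⟨k, -, rfl⟩ := List.mem_map.1 hw
    exact hW _ (mem_range_self k))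
  refine ⟨g, ?_⟩
  rintro _ ⟨k, rfl⟩
  filter_upwards [eventually_ge_atTop k] with n hn
  have hk : eval (MonoidHom.id G) (g n) (f k) ≠ 1 :=
    hg n _ (List.mem_map.2 ⟨k, List.mem_range.2 (by omega), rfl⟩)
  rw [eval_inr_inl_of]
  exact iff_of_false hk fun h0 => hk (by rw [h0, map_one])

end Filtration

end WordLimit

/-! ### The first Grigorchuk group acts in a separating way -/

namespace Grigorchuk

open Set Filter Topology

/-- The sequence `eξ`. -/
def consDigit (e : Bool) (ξ : Boundary) : Boundary
  | 0 => e
  | n + 1 => ξ n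

/-- The sequence without its first digit. -/
def tail (ξ : Boundary) : Boundary := fun i => ξ (i + 1)

@[simp] theorem consDigit_zero (e : Bool) (ξ : Boundary) : consDigit e ξ 0 = e := rfl

@[simp] theorem consDigit_succ (e : Bool) (ξ : Boundary) (n : ℕ) :
    consDigit e ξ (n + 1) = ξ n := rfl

@[simp] theorem tail_consDigit (e : Bool) (ξ : Boundary) : tail (consDigit e ξ) = ξ := rfl

theorem consDigit_tail (ξ : Boundary) : consDigit (ξ 0) (tail ξ) = ξ := by
  funext n
  cases n <;> rfl

theorem perm_consDigit (s : State) (e : Bool) (ξ : Boundary) :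
    perm s (consDigit e ξ) = consDigit (s.out e) (perm (s.next e) ξ) := by
  funext n
  cases n <;> rfl

theorem perm_one : perm .one = 1 := by
  ext ξ n
  change act .one ξ n = ξ n
  induction n generalizing ξ with
  | zero => rfl
  | succ n ih => exact ih _

theorem perm_mul_self (s : State) : perm s * perm s = 1 :=
  Equiv.ext fun ξ => act_act s ξ

theorem perm_inv (s : State) : (perm s)⁻¹ = perm s :=
  inv_eq_of_mul_eq_one_left (perm_mul_self s)

theorem apply_inv_apply (f : Equiv.Perm Boundary) (ξ : Boundary) : f (f⁻¹ ξ) = ξ :=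
  f.apply_symm_apply ξ

theorem ext_consDigit {f g : Equiv.Perm Boundary}
    (h : ∀ e ξ, f (consDigit e ξ) = g (consDigit e ξ)) : f = g := by
  ext1 ξ
  rw [← consDigit_tail ξ, h]

/-- The relations `bc = d`, `cd = b`, `db = c` need a common induction: passing to the sections at
the digit `1` permutes them cyclically, and at `0` they reduce to `a² = 1` or are trivial. -/
theorem perm_c_mul_perm_d : perm .c * perm .d = perm .b := by
  have key : ∀ (n : ℕ) (ξ : Boundary), act .b (act .c ξ) n = act .d ξ n ∧
      act .c (act .d ξ) n = act .b ξ n ∧ act .d (act .b ξ) n = act .c ξ n := by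
    intro n
    induction n with
    | zero => intro ξ; exact ⟨rfl, rfl, rfl⟩
    | succ n ih =>
      intro ξ
      have h1 : ∀ (s t : State), t.out (ξ 0) = ξ 0 → act s (act t ξ) (n + 1) =
          perm (s.next (ξ 0)) (perm (t.next (ξ 0)) (tail ξ)) n := by
        intro s t ht
        change act (s.next (t.out (ξ 0))) (act (t.next (ξ 0)) (tail ξ)) n = _
        rw [ht]
        rfl
      have h2 : ∀ s : State, act s ξ (n + 1) = perm (s.next (ξ 0)) (tail ξ) n := fun s => rfl
      rw [h1 _ _ rfl, h1 _ _ rfl, h1 _ _ rfl, h2, h2, h2]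
      cases ξ 0
      · simp only [State.next, perm_one, Equiv.Perm.one_apply, and_true]
        exact congrFun (act_act .a (tail ξ)) n
      · obtain ⟨i1, i2, i3⟩ := ih (tail ξ)
        exact ⟨i2, i3, i1⟩
  exact Equiv.ext fun ξ => funext fun n => (key n ξ).2.1

/-- The permutation that acts as `k` on the sequences that start with `e`, and trivially on the
other ones. -/
def atDigit (e : Bool) (k : Equiv.Perm Boundary) : Equiv.Perm Boundary where
  toFun ξ := if ξ 0 = e then consDigit e (k (tail ξ)) else ξ
  invFun ξ := if ξ 0 = e then consDigit e (k⁻¹ (tail ξ)) else ξ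
  left_inv ξ := by
    by_cases h : ξ 0 = e
    · subst h; simp [consDigit_tail]
    · simp [h]
  right_inv ξ := by
    by_cases h : ξ 0 = e
    · subst h; simp [consDigit_tail]
    · simp [h]

theorem atDigit_consDigit (e : Bool) (k : Equiv.Perm Boundary) (ξ : Boundary) :
    atDigit e k (consDigit e ξ) = consDigit e (k ξ) := by simp [atDigit]

theorem atDigit_of_ne {e : Bool} (k : Equiv.Perm Boundary) {ξ : Boundary} (h : ξ 0 ≠ e) :
    atDigit e k ξ = ξ := by simp [atDigit, h]

theorem atDigit_mul (e : Bool) (k k' : Equiv.Perm Boundary) :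
    atDigit e (k * k') = atDigit e k * atDigit e k' := by
  ext1 ξ
  by_cases h : ξ 0 = e
  · subst h
    rw [← consDigit_tail ξ, consDigit_zero, Equiv.Perm.mul_apply, atDigit_consDigit,
      atDigit_consDigit, atDigit_consDigit, Equiv.Perm.mul_apply]
  · rw [Equiv.Perm.mul_apply, atDigit_of_ne _ h, atDigit_of_ne _ h, atDigit_of_ne _ h]

/-- `atDigit` as a homomorphism. -/
def atDigitHom (e : Bool) : Equiv.Perm Boundary →* Equiv.Perm Boundary :=
  MonoidHom.mk' (atDigit e) (atDigit_mul e)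

/-! ### The branching subgroup `K` -/

/-- The element `(ab)²`. -/
def abSq : Equiv.Perm Boundary := perm .a * perm .b * perm .a * perm .b

/-- The normal closure of `(ab)²` in the Grigorchuk group. -/
def K : Subgroup (Equiv.Perm Boundary) :=
  Subgroup.closure {k | ∃ γ ∈ Γ, k = γ * abSq * γ⁻¹}

theorem perm_mem (s : State) : perm s ∈ Γ := by
  cases s
  · rw [perm_one]; exact Γ.one_mem
  all_goals exact Subgroup.subset_closure (by simp)

theorem abSq_mem : abSq ∈ Γ :=
  Γ.mul_mem (Γ.mul_mem (Γ.mul_mem (perm_mem _) (perm_mem _)) (perm_mem _)) (perm_mem _)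

theorem K_le : K ≤ Γ := by
  refine (Subgroup.closure_le _).2 ?_
  rintro _ ⟨γ, hγ, rfl⟩
  exact Γ.mul_mem (Γ.mul_mem hγ abSq_mem) (Γ.inv_mem hγ)

theorem abSq_mem_K : abSq ∈ K :=
  Subgroup.subset_closure ⟨1, Γ.one_mem, by simp⟩

theorem conj_mem_K {k γ : Equiv.Perm Boundary} (hk : k ∈ K) (hγ : γ ∈ Γ) : γ * k * γ⁻¹ ∈ K := by
  have : K ≤ K.comap (MulAut.conj γ).toMonoidHom := by
    refine (Subgroup.closure_le _).2 ?_
    rintro _ ⟨δ, hδ, rfl⟩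
    refine Subgroup.subset_closure ⟨γ * δ, Γ.mul_mem hγ hδ, ?_⟩
    simp [mul_assoc]
  exact this hk

/-- Sections at `0` realize all generators: `b`, `ada`, `aba`, `aca` have the sections `a`, `b`,
`c`, `d` there. -/
theorem exists_mem_consDigit_false {γ : Equiv.Perm Boundary} (hγ : γ ∈ Γ) :
    ∃ δ ∈ Γ, ∀ ξ, δ (consDigit false ξ) = consDigit false (γ ξ) := by
  induction hγ using Subgroup.closure_induction with
  | one => exact ⟨1, Γ.one_mem, fun ξ => rfl⟩
  | mul x y _ _ hx hy =>
    obtain ⟨δ, hδ, h⟩ := hx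
    obtain ⟨δ', hδ', h'⟩ := hy
    exact ⟨δ * δ', Γ.mul_mem hδ hδ', fun ξ => by
      rw [Equiv.Perm.mul_apply, h', h, Equiv.Perm.mul_apply]⟩
  | inv x _ hx =>
    obtain ⟨δ, hδ, h⟩ := hx
    refine ⟨δ⁻¹, Γ.inv_mem hδ, fun ξ => ?_⟩
    rw [Equiv.Perm.inv_eq_iff_eq, h, apply_inv_apply]
  | mem x hx =>
    have conj : ∀ s : State, perm .a * perm s * perm .a ∈ Γ := fun s =>
      Γ.mul_mem (Γ.mul_mem (perm_mem _) (perm_mem _)) (perm_mem _)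
    rcases hx with rfl | rfl | rfl | rfl
    · exact ⟨perm .b, perm_mem _, fun ξ => by rw [perm_consDigit]; rfl⟩
    · exact ⟨_, conj .d, fun ξ => by
        simp [perm_consDigit, State.out, State.next, perm_one]⟩
    · exact ⟨_, conj .b, fun ξ => by
        simp [perm_consDigit, State.out, State.next, perm_one]⟩
    · exact ⟨_, conj .c, fun ξ => by
        simp [perm_consDigit, State.out, State.next, perm_one]⟩

theorem atDigit_conj {γ δ : Equiv.Perm Boundary}
    (h : ∀ ξ, δ (consDigit false ξ) = consDigit false (γ ξ)) (k : Equiv.Perm Boundary) :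
    atDigit false (γ * k * γ⁻¹) = δ * atDigit false k * δ⁻¹ := by
  have h' : ∀ ξ, δ⁻¹ (consDigit false ξ) = consDigit false (γ⁻¹ ξ) := fun ξ => by
    rw [Equiv.Perm.inv_eq_iff_eq, h, apply_inv_apply]
  ext1 ξ
  rw [Equiv.Perm.mul_apply, Equiv.Perm.mul_apply]
  by_cases hξ : ξ 0 = false
  · rw [← consDigit_tail ξ, hξ, h', atDigit_consDigit, atDigit_consDigit, h]
    rfl
  · have : (δ⁻¹ ξ) 0 ≠ false := by
      intro h0
      apply hξ
      rw [← apply_inv_apply δ ξ, ← consDigit_tail (δ⁻¹ ξ), h0, h]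
      rfl
    rw [atDigit_of_ne _ hξ, atDigit_of_ne _ this, apply_inv_apply]

/-- In terms of sections, `(ab)² = (ca, ac)` and `aca = (d, a)`. The right side is therefore `(ac ·
dacd, ca · ac)`, which equals `(abab, 1)` because `cd = b`. -/
theorem atDigit_false_abSq :
    atDigit false abSq = abSq⁻¹ * ((perm .a * perm .c * perm .a) * abSq⁻¹ *
      (perm .a * perm .c * perm .a)⁻¹) := by
  have h1 : abSq⁻¹ = perm .b * perm .a * perm .b * perm .a := by
    simp [abSq, perm_inv, mul_assoc]
  have h2 : (perm .a * perm .c * perm .a)⁻¹ = perm .a * perm .c * perm .a := by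
    simp [perm_inv, mul_assoc]
  rw [h1, h2]
  have hb : ∀ ξ, perm .c (perm .d ξ) = perm .b ξ := fun ξ =>
    DFunLike.congr_fun perm_c_mul_perm_d ξ
  have hs : ∀ (s : State) (ξ : Boundary), perm s (perm s ξ) = ξ := fun s ξ => act_act s ξ
  refine ext_consDigit fun e ξ => ?_
  cases e
  · rw [atDigit_consDigit]
    simp only [abSq, Equiv.Perm.mul_apply, perm_consDigit, State.out, State.next, perm_one,
      Equiv.Perm.one_apply, Bool.not_true, Bool.not_false]
    rw [hb, hb]
  · rw [atDigit_of_ne _ (by simp)]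
    simp only [Equiv.Perm.mul_apply, perm_consDigit, State.out, State.next, perm_one,
      Equiv.Perm.one_apply, Bool.not_true, Bool.not_false]
    simp only [hs]

/-- For the digit `0`, a conjugate of `(ab)²` by `γ` is lifted to a conjugate by an element with
section `γ`, which leaves only `(ab)²` itself. Conjugation by `a` exchanges the two digits. -/
theorem atDigit_mem_K (e : Bool) {k : Equiv.Perm Boundary} (hk : k ∈ K) : atDigit e k ∈ K := by
  have h0 : ∀ k ∈ K, atDigit false k ∈ K := by
    have : K ≤ K.comap (atDigitHom false) := by
      refine (Subgroup.closure_le _).2 ?_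
      rintro _ ⟨γ, hγ, rfl⟩
      obtain ⟨δ, hδ, h⟩ := exists_mem_consDigit_false hγ
      change atDigit false _ ∈ K
      rw [atDigit_conj h]
      refine conj_mem_K ?_ hδ
      rw [atDigit_false_abSq]
      exact K.mul_mem (K.inv_mem abSq_mem_K) (conj_mem_K (K.inv_mem abSq_mem_K)
        (Γ.mul_mem (Γ.mul_mem (perm_mem _) (perm_mem _)) (perm_mem _)))
    exact fun k hk => this hk
  cases e
  · exact h0 k hk
  · have : atDigit true k = perm .a * atDigit false k * (perm .a)⁻¹ := by
      rw [perm_inv]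
      refine ext_consDigit fun e ξ => ?_
      rw [Equiv.Perm.mul_apply, Equiv.Perm.mul_apply, perm_consDigit]
      cases e
      · rw [atDigit_of_ne _ (by simp), atDigit_of_ne _ (by simp [State.out]), perm_consDigit]
        simp [State.out, State.next, perm_one]
      · simp only [State.out, State.next, perm_one, Bool.not_true, atDigit_consDigit,
          perm_consDigit, Bool.not_false, Equiv.Perm.one_apply]
    rw [this]
    exact conj_mem_K (h0 k hk) (perm_mem _)

/-- The permutation that acts as `k` below the vertex given by the first `n` digits of `x`. -/
def atVertex (k : Equiv.Perm Boundary) : ℕ → Boundary → Equiv.Perm Boundary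
  | 0, _ => k
  | n + 1, x => atDigit (x 0) (atVertex k n (tail x))

theorem atVertex_mem_K {k : Equiv.Perm Boundary} (hk : k ∈ K) (n : ℕ) (x : Boundary) :
    atVertex k n x ∈ K := by
  induction n generalizing x with
  | zero => exact hk
  | succ n ih => exact atDigit_mem_K _ (ih _)

theorem atVertex_apply_of_lt (k : Equiv.Perm Boundary) {n : ℕ} (x ξ : Boundary) {i : ℕ}
    (hi : i < n) : atVertex k n x ξ i = ξ i := by
  induction n generalizing x ξ i with
  | zero => omega
  | succ n ih =>
    by_cases h : ξ 0 = x 0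
    · rw [atVertex, ← consDigit_tail ξ, h, atDigit_consDigit]
      rcases i with _ | i
      · rfl
      · exact ih (tail x) (tail ξ) (by omega)
    · rw [atVertex, atDigit_of_ne _ h]

theorem atVertex_apply_of_ne (k : Equiv.Perm Boundary) {n : ℕ} {x ξ : Boundary} {i : ℕ}
    (hi : i < n) (hne : ξ i ≠ x i) : atVertex k n x ξ = ξ := by
  induction n generalizing x ξ i with
  | zero => omega
  | succ n ih =>
    by_cases h : ξ 0 = x 0
    · rcases i with _ | i
      · exact absurd h hne
      · rw [atVertex, ← consDigit_tail ξ, h, atDigit_consDigit, ih (i := i) (by omega) hne]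
    · rw [atVertex, atDigit_of_ne _ h]

theorem atVertex_apply_ne {k : Equiv.Perm Boundary} (hk : ∀ ξ, k ξ ≠ ξ) (n : ℕ) (x : Boundary) :
    atVertex k n x x ≠ x := by
  induction n generalizing x with
  | zero => exact hk x
  | succ n ih =>
    intro h
    apply ih (tail x)
    have h1 : atVertex k (n + 1) x x = consDigit (x 0) (atVertex k n (tail x) (tail x)) := by
      conv_lhs => rw [atVertex, ← consDigit_tail x]
      exact atDigit_consDigit _ _ _
    rw [h1] at h
    exact congrArg tail h

/-- The sections `ca` and `ac` both switch their first digit, so `(ab)²` always changes the second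
digit. -/
theorem abSq_apply_ne (ξ : Boundary) : abSq ξ ≠ ξ := by
  intro h
  have := congrFun h 1
  rw [← consDigit_tail ξ, ← consDigit_tail (tail ξ)] at this
  cases h0 : ξ 0 <;>
    simp [h0, abSq, perm_consDigit, State.out, State.next, perm_one] at this

/-- The elements that fix the first `n` digits. -/
def levelStabilizer (n : ℕ) : Subgroup Γ where
  carrier := {g | ∀ ξ : Boundary, ∀ i < n, (g • ξ) i = ξ i}
  one_mem' := fun ξ i _ => by rw [one_smul]
  mul_mem' := fun {g h} hg hh ξ i hi => by rw [mul_smul, hg _ i hi, hh _ i hi]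
  inv_mem' := fun {g} hg ξ i hi => by
    have := hg (g⁻¹ • ξ) i hi
    rw [smul_inv_smul] at this
    exact this.symm

instance continuousConstSMul : ContinuousConstSMul Γ Boundary := by
  have hperm : ∀ s : State, Continuous (act s) := by
    intro s
    refine continuous_pi fun n => ?_
    induction n generalizing s with
    | zero => exact (continuous_of_discreteTopology (f := s.out)).comp (continuous_apply 0)
    | succ n ih =>
      have : (fun ξ : Boundary => act s ξ (n + 1)) = fun ξ =>
          bif ξ 0 then act (s.next true) (tail ξ) n else act (s.next false) (tail ξ) n := by
        funext ξ
        change act (s.next (ξ 0)) (tail ξ) n = _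
        cases ξ 0 <;> rfl
      rw [this]
      have ht : Continuous tail := continuous_pi fun i => continuous_apply (i + 1)
      have hc : Continuous fun q : Bool × Bool × Bool => bif q.1 then q.2.1 else q.2.2 :=
        continuous_of_discreteTopology
      exact hc.comp ((continuous_apply 0).prodMk (((ih _).comp ht).prodMk ((ih _).comp ht)))
  -- Continuity of the inverse is carried along for the inversion step of the closure induction.
  have key : ∀ g ∈ Γ, Continuous g ∧ Continuous (g⁻¹ : Equiv.Perm Boundary) := by
    intro g hg
    induction hg using Subgroup.closure_induction with
    | one => exact ⟨continuous_id, continuous_id⟩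
    | mul x y _ _ hx hy =>
      rw [mul_inv_rev]
      exact ⟨hx.1.comp hy.1, hy.2.comp hx.2⟩
    | inv x _ hx => rw [inv_inv]; exact hx.symm
    | mem x hx => rcases hx with rfl | rfl | rfl | rfl <;> exact ⟨hperm _, hperm _⟩
  exact ⟨fun g => (key g g.2).1⟩

theorem isSeparatingFiltration :
    WordLimit.IsSeparatingFiltration (X := Boundary) levelStabilizer univ where
  antitone n k hnk g hg ξ i hi := hg ξ i (by omega)
  small q A hA := by
    rw [nhds_pi, Filter.mem_pi] at hA
    obtain ⟨I, hI, t, ht, hsub⟩ := hA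
    obtain ⟨M, hM⟩ := hI.bddAbove
    refine ⟨M + 1, I.pi t, set_pi_mem_nhds hI fun i _ => ht i, fun g hg ξ hξ => hsub ?_⟩
    intro i hi
    rw [hg ξ i (Nat.lt_succ_of_le (hM hi))]
    exact hξ i hi
  smul_mem _ _ _ := mem_univ _
  dense := dense_univ
  separating n Y hY x _ hx := by
    -- At depth `N` the vertex on the branch `x` lies below level `n` and off all branches in `Y`; a
    -- copy of `(ab)²` placed there separates.
    obtain ⟨N, hnN, hN⟩ : ∃ N ≥ n, ∀ y ∈ Y, ∃ i < N, y i ≠ x i := by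
      have h1 : ∀ y ∈ Y, ∃ i, y i ≠ x i := fun y hy => by
        by_contra! hcon
        exact hx (funext hcon ▸ hy)
      choose! f hf using h1
      obtain ⟨M, hM⟩ := (hY.image f).bddAbove
      exact ⟨max n (M + 1), le_max_left _ _, fun y hy => ⟨f y,
        lt_of_lt_of_le (Nat.lt_succ_of_le (hM (mem_image_of_mem f hy))) (le_max_right _ _),
        hf y hy⟩⟩
    refine ⟨⟨atVertex abSq N x, K_le (atVertex_mem_K abSq_mem_K N x)⟩, ?_, ?_, ?_⟩
    · exact fun ξ i hi => atVertex_apply_of_lt _ _ _ (by omega)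
    · intro y hy
      obtain ⟨i, hi, hne⟩ := hN y hy
      exact atVertex_apply_of_ne _ hi hne
    · exact atVertex_apply_ne abSq_apply_ne N x

theorem closure_generators {m : ℕ} (g : Fin m → Γ) :
    Subgroup.closure (range (Fin.append g ![a, b, c, d])) = ⊤ := by
  have htop : Subgroup.closure ((↑) ⁻¹' {perm .a, perm .b, perm .c, perm .d} : Set Γ) = ⊤ :=
    Subgroup.closure_closure_coe_preimage
  rw [eq_top_iff, ← htop, Subgroup.closure_le]
  intro x hx
  have h : ∀ j, ![a, b, c, d] j ∈ Subgroup.closure (range (Fin.append g ![a, b, c, d])) :=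
    fun j => Subgroup.subset_closure ⟨Fin.natAdd m j, Fin.append_right _ _ _⟩
  rcases hx with hx | hx | hx | hx
  · exact (Subtype.ext hx : x = a) ▸ h 0
  · exact (Subtype.ext hx : x = b) ▸ h 1
  · exact (Subtype.ext hx : x = c) ▸ h 2
  · exact (Subtype.ext hx : x = d) ▸ h 3

instance countable : Countable Γ :=
  WordLimit.countable_of_closure_eq_top (closure_generators (m := 0) Fin.elim0)

end Grigorchuk

/-! ### Thompson's group acts in a separating way -/

namespace Thompson

open Set Filter Topology

theorem IsDyadic.not_irrational {t : ℝ} (ht : IsDyadic t) : ¬ Irrational t := by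
  obtain ⟨z, n, rfl⟩ := ht
  intro h
  exact h ⟨z / 2 ^ n, by push_cast; rfl⟩

instance continuousConstSMul : ContinuousConstSMul F unitInterval :=
  ⟨fun g => (g : unitInterval ≃o unitInterval).continuous⟩

theorem smul_le_smul_iff (g : F) {s t : unitInterval} : g • s ≤ g • t ↔ s ≤ t :=
  (g : unitInterval ≃o unitInterval).le_iff_le

/-- A copy of `x_0` on the interval `[a, a + l]`. -/
def bumpFun (a l t : ℝ) : ℝ :=
  if t ≤ a then t
  else if t ≤ a + l / 2 then (t + a) / 2
  else if t ≤ a + 3 * l / 4 then t - l / 4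
  else if t ≤ a + l then 2 * t - (a + l)
  else t

/-- The inverse of `bumpFun`. -/
def bumpInv (a l t : ℝ) : ℝ :=
  if t ≤ a then t
  else if t ≤ a + l / 4 then 2 * t - a
  else if t ≤ a + l / 2 then t + l / 4
  else if t ≤ a + l then (t + a + l) / 2
  else t

theorem bumpFun_bumpInv {a l : ℝ} (hl : 0 < l) (t : ℝ) : bumpFun a l (bumpInv a l t) = t := by
  unfold bumpInv
  split_ifs <;> unfold bumpFun <;> split_ifs <;> linarith

theorem bumpFun_strictMono {a l : ℝ} (hl : 0 < l) : StrictMono (bumpFun a l) := by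
  intro s t hst
  unfold bumpFun
  split_ifs <;> linarith

theorem bumpFun_mem {a l : ℝ} (ha : 0 ≤ a) (hl : 0 < l) (hal : a + l ≤ 1) (t : unitInterval) :
    bumpFun a l t ∈ unitInterval := by
  have h0 := t.2.1
  have h1 := t.2.2
  unfold bumpFun
  split_ifs <;> constructor <;> linarith

theorem bumpInv_mem {a l : ℝ} (ha : 0 ≤ a) (hl : 0 < l) (hal : a + l ≤ 1) (t : unitInterval) :
    bumpInv a l t ∈ unitInterval := by
  have h0 := t.2.1
  have h1 := t.2.2
  unfold bumpInv
  split_ifs <;> constructor <;> linarith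

/-- `bumpFun` as an increasing bijection of `[0, 1]`. -/
def bumpIso {a l : ℝ} (ha : 0 ≤ a) (hl : 0 < l) (hal : a + l ≤ 1) :
    unitInterval ≃o unitInterval :=
  StrictMono.orderIsoOfRightInverse (fun t => ⟨bumpFun a l t, bumpFun_mem ha hl hal t⟩)
    (fun _ _ h => bumpFun_strictMono hl h)
    (fun t => ⟨bumpInv a l t, bumpInv_mem ha hl hal t⟩)
    (fun t => Subtype.ext (bumpFun_bumpInv hl t))

theorem bumpIso_mem {a l : ℝ} (ha : 0 ≤ a) (hl : 0 < l) (hal : a + l ≤ 1) (hda : IsDyadic a)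
    (hdl : IsDyadic l) : bumpIso ha hl hal ∈ F := by
  have d2 : IsDyadic (a + l / 2) := by
    have := hda.add (hdl.zpow_mul (-1))
    rwa [zpow_neg_one, inv_mul_eq_div] at this
  have d3 : IsDyadic (a + 3 * l / 4) := by
    have h4 := hdl.zpow_mul (-2)
    have := ((hda.add hdl).sub h4)
    convert this using 1
    norm_num [zpow_neg]
    ring
  let p1 : unitInterval := ⟨a, by constructor <;> linarith⟩
  let p2 : unitInterval := ⟨a + l / 2, by constructor <;> linarith⟩
  let p3 : unitInterval := ⟨a + 3 * l / 4, by constructor <;> linarith⟩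
  let p4 : unitInterval := ⟨a + l, by constructor <;> linarith⟩
  refine ⟨{p1, p2, p3, p4}, ?_, fun u v huv hno => ?_⟩
  · intro s hs
    simp only [Finset.mem_insert, Finset.mem_singleton] at hs
    rcases hs with rfl | rfl | rfl | rfl
    · exact hda
    · exact d2
    · exact d3
    · exact hda.add hdl
  · have n1 : ¬ ((u : ℝ) < a ∧ a < (v : ℝ)) := hno p1 (by simp)
    have n2 : ¬ ((u : ℝ) < a + l / 2 ∧ a + l / 2 < (v : ℝ)) := hno p2 (by simp)
    have n3 : ¬ ((u : ℝ) < a + 3 * l / 4 ∧ a + 3 * l / 4 < (v : ℝ)) := hno p3 (by simp)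
    have n4 : ¬ ((u : ℝ) < a + l ∧ a + l < (v : ℝ)) := hno p4 (by simp)
    have main : ∀ (k : ℤ) (c : ℝ),
        (∀ t : ℝ, (u : ℝ) ≤ t → t ≤ v → bumpFun a l t = 2 ^ k * t + c) →
        ∃ (k : ℤ) (c : ℝ), ∀ t, u ≤ t → t ≤ v →
          (bumpIso ha hl hal t : ℝ) = 2 ^ k * (t : ℝ) + c :=
      fun k c h => ⟨k, c, fun t ht ht' => h t ht ht'⟩
    by_cases c1 : (v : ℝ) ≤ a
    · refine main 0 0 fun t h1 h2 => ?_
      rw [zpow_zero]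
      unfold bumpFun
      split_ifs <;> linarith
    have c1' : a ≤ (u : ℝ) := by
      by_contra h
      exact n1 ⟨not_le.1 h, not_le.1 c1⟩
    by_cases c2 : (v : ℝ) ≤ a + l / 2
    · refine main (-1) (a / 2) fun t h1 h2 => ?_
      rw [zpow_neg_one]
      unfold bumpFun
      split_ifs <;> linarith
    have c2' : a + l / 2 ≤ (u : ℝ) := by
      by_contra h
      exact n2 ⟨not_le.1 h, not_le.1 c2⟩
    by_cases c3 : (v : ℝ) ≤ a + 3 * l / 4
    · refine main 0 (-(l / 4)) fun t h1 h2 => ?_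
      rw [zpow_zero]
      unfold bumpFun
      split_ifs <;> linarith
    have c3' : a + 3 * l / 4 ≤ (u : ℝ) := by
      by_contra h
      exact n3 ⟨not_le.1 h, not_le.1 c3⟩
    by_cases c4 : (v : ℝ) ≤ a + l
    · refine main 1 (-(a + l)) fun t h1 h2 => ?_
      rw [zpow_one]
      unfold bumpFun
      split_ifs <;> linarith
    have c4' : a + l ≤ (u : ℝ) := by
      by_contra h
      exact n4 ⟨not_le.1 h, not_le.1 c4⟩
    refine main 0 0 fun t h1 h2 => ?_
    rw [zpow_zero]
    unfold bumpFun
    split_ifs <;> linarith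

/-- Every interval between neighbouring multiples of `2⁻ⁿ` supports an element of `F` that moves all
of its interior points. -/
theorem exists_bump {n k : ℕ} (hk : k + 1 ≤ 2 ^ n) : ∃ g : F,
    (∀ t : unitInterval, ¬ ((k : ℝ) < 2 ^ n * t ∧ 2 ^ n * (t : ℝ) < k + 1) → g • t = t) ∧
    ∀ t : unitInterval, (k : ℝ) < 2 ^ n * t → 2 ^ n * (t : ℝ) < k + 1 → g • t ≠ t := by
  have hp : (0 : ℝ) < 2 ^ n := by positivity
  have hk' : (k : ℝ) + 1 ≤ 2 ^ n := by exact_mod_cast hk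
  have ha : (0 : ℝ) ≤ k / 2 ^ n := by positivity
  have hl : (0 : ℝ) < 1 / 2 ^ n := by positivity
  have hal : (k : ℝ) / 2 ^ n + 1 / 2 ^ n ≤ 1 := by
    rw [← add_div, div_le_one hp]; exact hk'
  have i1 : ∀ t : ℝ, (k : ℝ) < 2 ^ n * t ↔ (k : ℝ) / 2 ^ n < t := fun t => by
    rw [div_lt_iff₀' hp]
  have i2 : ∀ t : ℝ, 2 ^ n * t < (k : ℝ) + 1 ↔ t < (k : ℝ) / 2 ^ n + 1 / 2 ^ n := fun t => by
    rw [← add_div, lt_div_iff₀' hp]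
  refine ⟨⟨bumpIso ha hl hal, bumpIso_mem ha hl hal ⟨k, n, by simp⟩ ⟨1, n, by simp⟩⟩, ?_, ?_⟩
  · intro t ht
    rw [i1, i2, not_and_or, not_lt, not_lt] at ht
    apply Subtype.ext
    change bumpFun _ _ _ = _
    unfold bumpFun
    split_ifs <;> rcases ht with ht | ht <;> linarith
  · intro t h1 h2 h0
    rw [i1] at h1
    rw [i2] at h2
    have h0 : bumpFun ((k : ℝ) / 2 ^ n) (1 / 2 ^ n) t = t := congrArg Subtype.val h0
    unfold bumpFun at h0
    split_ifs at h0 <;> linarith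

/-- The elements that fix all multiples of `2⁻ⁿ`. -/
def gridStabilizer (n : ℕ) : Subgroup F where
  carrier := {g | ∀ t : unitInterval, (∃ k : ℕ, 2 ^ n * (t : ℝ) = k) → g • t = t}
  one_mem' := fun t _ => one_smul _ t
  mul_mem' := fun {g h} hg hh t ht => by rw [mul_smul, hh t ht, hg t ht]
  inv_mem' := fun {g} hg t ht => by rw [inv_smul_eq_iff, hg t ht]

/-- The floor of `2ⁿ t`, for `t < 1`. -/
theorem exists_grid (n : ℕ) {t : unitInterval} (ht : (t : ℝ) < 1) :
    ∃ k : ℕ, k + 1 ≤ 2 ^ n ∧ (k : ℝ) ≤ 2 ^ n * t ∧ 2 ^ n * (t : ℝ) < k + 1 := by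
  have hp : (0 : ℝ) < 2 ^ n := by positivity
  have h0 : (0 : ℝ) ≤ 2 ^ n * t := mul_nonneg hp.le t.2.1
  refine ⟨⌊2 ^ n * (t : ℝ)⌋₊, ?_, Nat.floor_le h0, Nat.lt_floor_add_one _⟩
  rw [Nat.succ_le_iff, Nat.floor_lt h0]
  push_cast
  nlinarith

/-- By monotonicity, an element fixing the grid preserves each grid interval. -/
theorem abs_smul_sub_le {n : ℕ} {g : F} (hg : g ∈ gridStabilizer n) (t : unitInterval) :
    |((g • t : unitInterval) : ℝ) - t| ≤ 1 / 2 ^ n := by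
  have hp : (0 : ℝ) < 2 ^ n := by positivity
  rcases t.2.2.lt_or_eq with ht | ht
  · obtain ⟨k, hk, h1, h2⟩ := exists_grid n ht
    have hk' : (k : ℝ) + 1 ≤ 2 ^ n := by exact_mod_cast hk
    have hu : (k : ℝ) / 2 ^ n ≤ t := by rwa [div_le_iff₀' hp]
    have hv : (t : ℝ) ≤ (k + 1) / 2 ^ n := by rw [le_div_iff₀' hp]; exact h2.le
    let u : unitInterval := ⟨k / 2 ^ n, by positivity, by rw [div_le_one hp]; linarith⟩
    let v : unitInterval := ⟨(k + 1) / 2 ^ n, by positivity, by rwa [div_le_one hp]⟩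
    have hgu : g • u = u := hg u ⟨k, mul_div_cancel₀ _ hp.ne'⟩
    have hgv : g • v = v := hg v ⟨k + 1, by push_cast; exact mul_div_cancel₀ _ hp.ne'⟩
    have e1 : ((k : ℝ) / 2 ^ n) ≤ (g • t : unitInterval) := by
      have := (smul_le_smul_iff g (s := u) (t := t)).2 hu
      rwa [hgu] at this
    have e2 : ((g • t : unitInterval) : ℝ) ≤ (k + 1) / 2 ^ n := by
      have := (smul_le_smul_iff g (s := t) (t := v)).2 hv
      rwa [hgv] at this
    rw [add_div] at e2 hv
    rw [abs_le]
    constructor <;> linarith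
  · have : g • t = t := hg t ⟨2 ^ n, by rw [ht]; push_cast; ring⟩
    rw [this, sub_self, abs_zero]
    positivity

theorem exists_one_div_two_pow_lt {ε : ℝ} (hε : 0 < ε) : ∃ n : ℕ, ∀ k ≥ n, (1 : ℝ) / 2 ^ k < ε := by
  obtain ⟨n, hn⟩ := exists_pow_lt_of_lt_one hε (by norm_num : (1 / 2 : ℝ) < 1)
  refine ⟨n, fun k hk => lt_of_le_of_lt ?_ hn⟩
  rw [one_div_pow]
  exact one_div_le_one_div_of_le (by positivity) (pow_le_pow_right₀ (by norm_num) hk)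

/-- Dyadic points have to be left out of `X'`, since each of them is fixed by `gridStabilizer n` for
all large `n`. -/
theorem isSeparatingFiltration :
    WordLimit.IsSeparatingFiltration (X := unitInterval) gridStabilizer
      {t | ¬ IsDyadic (t : ℝ)} where
  antitone n k hnk g hg t := by
    rintro ⟨j, hj⟩
    refine hg t ⟨2 ^ (k - n) * j, ?_⟩
    push_cast
    rw [← hj, ← mul_assoc, ← pow_add, Nat.sub_add_cancel hnk]
  small q A hA := by
    obtain ⟨ε, hε, hA⟩ := Metric.mem_nhds_iff.1 hA
    obtain ⟨n, hn⟩ := exists_one_div_two_pow_lt (half_pos hε)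
    refine ⟨n, Metric.ball q (ε / 2), Metric.ball_mem_nhds _ (half_pos hε), ?_⟩
    intro g hg t ht
    apply hA
    have h1 := abs_smul_sub_le hg t
    have h2 := hn n le_rfl
    have h3 : dist (g • t) t < ε / 2 := lt_of_le_of_lt h1 h2
    rw [Metric.mem_ball] at ht ⊢
    linarith [dist_triangle (g • t) t q]
  smul_mem g t ht := fun h => ht ((IsDyadicPL.isDyadic_iff g.2 t).1 h)
  dense := by
    rw [Metric.dense_iff]
    intro t r hr
    have h0 := t.2.1
    have h1 := t.2.2
    obtain ⟨s, hs, hs1, hs2⟩ := exists_irrational_btwn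
      (show max 0 ((t : ℝ) - r) < min 1 (t + r) by
        rw [lt_min_iff, max_lt_iff, max_lt_iff]
        refine ⟨⟨?_, ?_⟩, ?_, ?_⟩ <;> linarith)
    rw [max_lt_iff] at hs1
    rw [lt_min_iff] at hs2
    refine ⟨⟨s, hs1.1.le, hs2.1.le⟩, ?_, fun h => h.not_irrational hs⟩
    rw [Metric.mem_ball, Subtype.dist_eq, Real.dist_eq, abs_lt]
    constructor <;> linarith [hs1.2, hs2.2]
  separating n Y hY t ht htY := by
    -- The interval of the grid `2⁻ᴹ` around `t` is too short to reach `Y`. As `t` is not dyadic it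
    -- is an interior point, so a bump on this interval moves it.
    obtain ⟨M, hMn, hM⟩ : ∃ M ≥ n, ∀ y ∈ Y, (1 : ℝ) / 2 ^ M < |(y : ℝ) - t| := by
      have h1 : ∀ y ∈ Y, ∃ k : ℕ, ∀ j ≥ k, (1 : ℝ) / 2 ^ j < |(y : ℝ) - t| := fun y hy =>
        exists_one_div_two_pow_lt (abs_pos.2 (sub_ne_zero.2 fun h =>
          htY ((Subtype.ext h : y = t) ▸ hy)))
      choose! f hf using h1
      obtain ⟨M, hM⟩ := (hY.image f).bddAbove
      exact ⟨max n M, le_max_left _ _, fun y hy =>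
        hf y hy _ ((hM (mem_image_of_mem f hy)).trans (le_max_right _ _))⟩
    have hp : (0 : ℝ) < 2 ^ M := by positivity
    have hdy : ∀ k : ℕ, 2 ^ M * (t : ℝ) ≠ k := fun k hk =>
      ht ⟨k, M, by rw [eq_div_iff hp.ne', mul_comm, hk]; push_cast; rfl⟩
    have ht1 : (t : ℝ) < 1 := lt_of_le_of_ne t.2.2 fun h => hdy (2 ^ M) (by rw [h]; simp)
    obtain ⟨k, hk, h1, h2⟩ := exists_grid M ht1
    obtain ⟨g, hg1, hg2⟩ := exists_bump hk
    have h1' : (k : ℝ) < 2 ^ M * t := lt_of_le_of_ne h1 (hdy k).symm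
    refine ⟨g, ?_, ?_, hg2 t h1' h2⟩
    · rintro s ⟨j, hj⟩
      refine hg1 s ?_
      have : (2 : ℝ) ^ M * s = ((2 ^ (M - n) * j : ℕ) : ℝ) := by
        push_cast
        rw [← hj, ← mul_assoc, ← pow_add, Nat.sub_add_cancel hMn]
      rw [this]
      rintro ⟨h3, h4⟩
      have h3 : k < 2 ^ (M - n) * j := by exact_mod_cast h3
      have h4 : 2 ^ (M - n) * j < k + 1 := by exact_mod_cast h4
      omega
    · intro y hy
      refine hg1 y ?_
      rintro ⟨h3, h4⟩
      have h5 := hM y hy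
      rw [div_lt_iff₀' hp, ← abs_of_pos hp, ← abs_mul, mul_sub] at h5
      have : |(2 : ℝ) ^ M * y - 2 ^ M * t| < 1 := by
        rw [abs_lt]
        constructor <;> linarith
      linarith

end Thompson

/-! ### Thompson's group is generated by `x_0` and `x_1` -/

namespace Thompson

open Set

/-- `f` maps the standard dyadic interval `[k/2ⁿ, (k+1)/2ⁿ]`, written as the pair `(n, k)`, affinely
onto another one. -/
def MapsAffinely (f : F) (I J : ℕ × ℕ) : Prop :=
  ∀ t : unitInterval, (I.2 : ℝ) ≤ 2 ^ I.1 * t → 2 ^ I.1 * (t : ℝ) ≤ I.2 + 1 →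
    2 ^ J.1 * ((f • t : unitInterval) : ℝ) - J.2 = 2 ^ I.1 * t - I.2

/-- The left half of a standard dyadic interval. -/
def leftHalf (I : ℕ × ℕ) : ℕ × ℕ := (I.1 + 1, 2 * I.2)

/-- The right half of a standard dyadic interval. -/
def rightHalf (I : ℕ × ℕ) : ℕ × ℕ := (I.1 + 1, 2 * I.2 + 1)

theorem MapsAffinely.one (I : ℕ × ℕ) : MapsAffinely 1 I I := fun t _ _ => by rw [one_smul]

theorem MapsAffinely.mul {f g : F} {I J K : ℕ × ℕ} (hg : MapsAffinely g J K)
    (hf : MapsAffinely f I J) : MapsAffinely (g * f) I K := by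
  intro t h1 h2
  have := hf t h1 h2
  rw [mul_smul, hg (f • t) (by linarith) (by linarith), this]

/-- `hI` places `I` inside `[0, 1]`, so its endpoints can be mapped; by monotonicity the preimage of
a point of `J` then lies in `I`. -/
theorem MapsAffinely.inv {f : F} {I J : ℕ × ℕ} (hf : MapsAffinely f I J)
    (hI : I.2 + 1 ≤ 2 ^ I.1) : MapsAffinely f⁻¹ J I := by
  intro t h1 h2
  have hp : (0 : ℝ) < 2 ^ I.1 := by positivity
  have hq : (0 : ℝ) < 2 ^ J.1 := by positivity
  have hI' : (I.2 : ℝ) + 1 ≤ 2 ^ I.1 := by exact_mod_cast hI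
  let u : unitInterval := ⟨I.2 / 2 ^ I.1, by positivity, by rw [div_le_one hp]; linarith⟩
  let v : unitInterval := ⟨(I.2 + 1) / 2 ^ I.1, by positivity, by rwa [div_le_one hp]⟩
  have eu : 2 ^ I.1 * (u : ℝ) = I.2 := mul_div_cancel₀ _ hp.ne'
  have ev : 2 ^ I.1 * (v : ℝ) = I.2 + 1 := mul_div_cancel₀ _ hp.ne'
  have hu := hf u eu.ge (by linarith)
  have hv := hf v (by linarith) ev.le
  have hut : f • u ≤ t := by
    rw [← Subtype.coe_le_coe, ← mul_le_mul_iff_right₀ hq]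
    linarith
  have htv : t ≤ f • v := by
    rw [← Subtype.coe_le_coe, ← mul_le_mul_iff_right₀ hq]
    linarith
  have h3 : u ≤ f⁻¹ • t := by rwa [← smul_le_smul_iff f, smul_inv_smul]
  have h4 : f⁻¹ • t ≤ v := by rwa [← smul_le_smul_iff f, smul_inv_smul]
  have h5 := hf (f⁻¹ • t)
    (by rw [← eu]; exact mul_le_mul_of_nonneg_left h3 hp.le)
    (by rw [← ev]; exact mul_le_mul_of_nonneg_left h4 hp.le)
  rw [smul_inv_smul] at h5
  exact h5.symm

theorem MapsAffinely.leftHalf {f : F} {I J : ℕ × ℕ} (hf : MapsAffinely f I J) :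
    MapsAffinely f (leftHalf I) (leftHalf J) := by
  intro t h1 h2
  simp only [Thompson.leftHalf, pow_succ, Nat.cast_mul, Nat.cast_ofNat] at h1 h2 ⊢
  have := hf t (by linarith) (by linarith)
  linarith

theorem MapsAffinely.rightHalf {f : F} {I J : ℕ × ℕ} (hf : MapsAffinely f I J) :
    MapsAffinely f (rightHalf I) (rightHalf J) := by
  intro t h1 h2
  simp only [Thompson.rightHalf, pow_succ, Nat.cast_mul, Nat.cast_ofNat, Nat.cast_add,
    Nat.cast_one] at h1 h2 ⊢
  have := hf t (by linarith) (by linarith)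
  linarith

theorem forall₂_mul {f g : F} {P Q R : List (ℕ × ℕ)} (hg : List.Forall₂ (MapsAffinely g) Q R)
    (hf : List.Forall₂ (MapsAffinely f) P Q) : List.Forall₂ (MapsAffinely (g * f)) P R := by
  induction hf generalizing R with
  | nil => cases hg; exact .nil
  | cons h _ ih =>
    cases hg with
    | cons h' hg => exact .cons (h'.mul h) (ih hg)

theorem exists_forall₂_append_cons {f : F} {P A B : List (ℕ × ℕ)} {I : ℕ × ℕ}
    (h : List.Forall₂ (MapsAffinely f) P (A ++ I :: B)) :
    ∃ A' I' B', P = A' ++ I' :: B' ∧ List.Forall₂ (MapsAffinely f) A' A ∧ MapsAffinely f I' I ∧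
      List.Forall₂ (MapsAffinely f) B' B := by
  induction A generalizing P with
  | nil =>
    cases h with
    | cons hI hB => exact ⟨[], _, _, rfl, .nil, hI, hB⟩
  | cons J A ih =>
    cases h with
    | cons hJ h =>
      obtain ⟨A', I', B', rfl, hA, hI, hB⟩ := ih h
      exact ⟨_ :: A', I', B', rfl, .cons hJ hA, hI, hB⟩

theorem forall₂_inv {f : F} {P Q : List (ℕ × ℕ)} (hf : List.Forall₂ (MapsAffinely f) P Q)
    (hP : ∀ I ∈ P, I.2 + 1 ≤ 2 ^ I.1) : List.Forall₂ (MapsAffinely f⁻¹) Q P := by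
  induction hf with
  | nil => exact .nil
  | cons h _ ih =>
    exact .cons (h.inv (hP _ List.mem_cons_self)) (ih fun I hI => hP I (List.mem_cons_of_mem _ hI))

/-! #### The generators -/

/-- The subgroup generated by `x_0` and `x_1`. -/
def H : Subgroup F := Subgroup.closure {x 0, x 1}

/-- `x_0` is `t ↦ 2t - 1` on `[3/4, 1]`, so conjugation by it doubles the scale of any `x_n`
supported there. -/
theorem xFun_comm {l : ℝ} (hl : 0 < l) (hl1 : l ≤ 1 / 2) (t : ℝ) :
    xFun 1 (xFun (l / 2) t) = xFun l (xFun 1 t) := by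
  rcases le_or_gt t (1 - l / 2) with ht | ht
  · have h1 : xFun (l / 2) t = t := if_pos ht
    have h2 : xFun 1 t ≤ 1 - l := by
      unfold xFun
      split_ifs <;> linarith
    have h3 : xFun l (xFun 1 t) = xFun 1 t := if_pos h2
    rw [h1, h3]
  · have h1 : xFun 1 t = 2 * t - 1 := by
      unfold xFun
      split_ifs <;> linarith
    have h2 : 1 - l / 2 < xFun (l / 2) t := by
      unfold xFun
      split_ifs <;> linarith
    have h3 : xFun 1 (xFun (l / 2) t) = 2 * xFun (l / 2) t - 1 := by
      generalize xFun (l / 2) t = s at h2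
      unfold xFun
      split_ifs <;> linarith
    rw [h1, h3]
    unfold xFun
    split_ifs <;> linarith

theorem x_mul (n : ℕ) : x 0 * x (n + 2) = x (n + 1) * x 0 := by
  apply Subtype.ext
  ext t
  change xFun ((1 / 2) ^ 0) (xFun ((1 / 2) ^ (n + 2)) t) =
    xFun ((1 / 2) ^ (n + 1)) (xFun ((1 / 2) ^ 0) t)
  have h : ((1 : ℝ) / 2) ^ (n + 2) = (1 / 2) ^ (n + 1) / 2 := by rw [pow_succ _ (n + 1)]; ring
  rw [pow_zero, h]
  refine xFun_comm (by positivity) ?_ _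
  rw [pow_succ]
  have := pow_le_one'' n
  linarith

theorem x_mem (n : ℕ) : x n ∈ H := by
  have h0 : x 0 ∈ H := Subgroup.subset_closure (by simp)
  induction n with
  | zero => exact h0
  | succ n ih =>
    rcases n with _ | n
    · exact Subgroup.subset_closure (by simp)
    · have : x (n + 2) = (x 0)⁻¹ * (x (n + 1) * x 0) := by rw [← x_mul, inv_mul_cancel_left]
      rw [this]
      exact H.mul_mem (H.inv_mem h0) (H.mul_mem ih h0)

/-- In the coordinate `2ⁿ t`, all break points and values become linear in `2ⁿ` and `2ⁿ t`, within
reach of linear arithmetic. -/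
theorem two_pow_mul_x (n : ℕ) (t : unitInterval) :
    2 ^ n * ((x n • t : unitInterval) : ℝ) =
      if 2 ^ n * (t : ℝ) ≤ 2 ^ n - 1 then 2 ^ n * (t : ℝ)
      else if 2 ^ n * (t : ℝ) ≤ 2 ^ n - 1 / 2 then 2 ^ n * (t : ℝ) / 2 + (2 ^ n - 1) / 2
      else if 2 ^ n * (t : ℝ) ≤ 2 ^ n - 1 / 4 then 2 ^ n * (t : ℝ) - 1 / 4
      else 2 * (2 ^ n * (t : ℝ)) - 2 ^ n := by
  change 2 ^ n * xFun ((1 / 2) ^ n) t = _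
  have hp : (0 : ℝ) < 2 ^ n := by positivity
  have hl : (2 : ℝ) ^ n * (1 / 2) ^ n = 1 := by rw [← mul_pow]; norm_num
  generalize (1 / 2 : ℝ) ^ n = l at hl
  generalize (2 : ℝ) ^ n = P at hl hp
  have i1 : (t : ℝ) ≤ 1 - l ↔ P * t ≤ P - 1 := by
    rw [← mul_le_mul_iff_right₀ hp, mul_sub, hl, mul_one]
  have i2 : (t : ℝ) ≤ 1 - l / 2 ↔ P * t ≤ P - 1 / 2 := by
    rw [← mul_le_mul_iff_right₀ hp, mul_sub, mul_div_assoc', hl, mul_one]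
  have i3 : (t : ℝ) ≤ 1 - l / 4 ↔ P * t ≤ P - 1 / 4 := by
    rw [← mul_le_mul_iff_right₀ hp, mul_sub, mul_div_assoc', hl, mul_one]
  unfold xFun
  simp only [i1, i2, i3]
  split_ifs
  · rfl
  · linear_combination (-1 / 2) * hl
  · linear_combination (-1 / 4) * hl
  · ring

/-! #### Partitions of the unit interval -/

/-- The list consists of consecutive standard dyadic intervals, from `a` to `1`. -/
def IsPartition : ℝ → List (ℕ × ℕ) → Prop
  | a, [] => a = 1
  | a, I :: l => (I.2 : ℝ) = 2 ^ I.1 * a ∧ IsPartition ((I.2 + 1) / 2 ^ I.1) l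

/-- The partition of `[1 - 2⁻ᵏ, 1]` with the division points `1 - 2⁻ᵏ⁻¹, …, 1 - 2⁻ᵏ⁻ⁿ`. -/
def vine : ℕ → ℕ → List (ℕ × ℕ)
  | k, 0 => [(k, 2 ^ k - 1)]
  | k, n + 1 => (k + 1, 2 ^ (k + 1) - 2) :: vine (k + 1) n

theorem vine_valid (k n : ℕ) : ∀ I ∈ vine k n, I.2 + 1 ≤ 2 ^ I.1 := by
  induction n generalizing k with
  | zero =>
    intro I hI
    obtain rfl := List.mem_singleton.1 hI
    have : 0 < 2 ^ k := by positivity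
    show 2 ^ k - 1 + 1 ≤ 2 ^ k
    omega
  | succ n ih =>
    intro I hI
    rcases List.mem_cons.1 hI with rfl | hI
    · have : 0 < 2 ^ k := by positivity
      show 2 ^ (k + 1) - 2 + 1 ≤ 2 ^ (k + 1)
      rw [pow_succ]
      omega
    · exact ih _ _ hI

theorem cast_two_pow_sub_one (k : ℕ) : ((2 ^ k - 1 : ℕ) : ℝ) = 2 ^ k - 1 := by
  rw [Nat.cast_sub Nat.one_le_two_pow]
  simp

theorem cast_two_pow_succ_sub_two (k : ℕ) : ((2 ^ (k + 1) - 2 : ℕ) : ℝ) = 2 * 2 ^ k - 2 := by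
  have : 2 ≤ 2 ^ (k + 1) := by
    have : 0 < 2 ^ k := by positivity
    rw [pow_succ]; omega
  rw [Nat.cast_sub this, pow_succ]
  push_cast
  ring

theorem x_shift_vine (k j n : ℕ) (hj : k < j) :
    List.Forall₂ (MapsAffinely (x k)) (vine (j + 1) n) (vine j n) := by
  have hpos : (0 : ℝ) < 2 ^ k := by positivity
  -- beyond `1 - 2⁻ᵏ⁻²`, the map `x k` is `t ↦ 2 t - 1`
  have key : ∀ t : unitInterval, (2 : ℝ) ^ (j + 1) - 1 ≤ 2 ^ (j + 1) * t →
      ((x k • t : unitInterval) : ℝ) = 2 * t - 1 := by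
    intro t ht
    have hx := two_pow_mul_x k t
    obtain ⟨i, rfl⟩ : ∃ i, j = k + 1 + i := ⟨j - (k + 1), by omega⟩
    have hi : (1 : ℝ) ≤ 2 ^ i := one_le_pow₀ (by norm_num)
    have e : (2 : ℝ) ^ (k + 1 + i + 1) = 4 * (2 ^ i * 2 ^ k) := by ring
    rw [e] at ht
    have ht' : (2 : ℝ) ^ k - 1 / 4 ≤ 2 ^ k * t := by
      have : (2 : ℝ) ^ i * (2 ^ k - 2 ^ k * t) ≤ 1 / 4 := by linarith
      have h0 : (0 : ℝ) ≤ 2 ^ k - 2 ^ k * t := by nlinarith [t.2.2]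
      nlinarith
    have : (2 : ℝ) ^ k * ((x k • t : unitInterval) : ℝ) = 2 ^ k * (2 * t - 1) := by
      rw [hx]
      split_ifs <;> linarith
    exact mul_left_cancel₀ hpos.ne' this
  -- Only `key` is needed from here on, and it passes from `j` to `j + 1`.
  clear hj
  induction n generalizing j with
  | zero =>
    refine .cons ?_ .nil
    intro t h1 h2
    simp only [cast_two_pow_sub_one] at h1 h2 ⊢
    rw [key t h1, pow_succ]
    ring
  | succ n ih =>
    refine .cons ?_ (ih (j + 1) fun t ht => key t ?_)
    · intro t h1 h2
      simp only [cast_two_pow_succ_sub_two] at h1 h2 ⊢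
      rw [key t (by rw [pow_succ _ (j + 1)] at h1; linarith)]
      ring
    · rw [pow_succ _ (j + 1)] at ht
      linarith [pow_pos (two_pos (α := ℝ)) (j + 1)]

/-- Halving an interval of a vine can be undone in `H`. -/
theorem exists_mem_vine_halve (n k : ℕ) (A B : List (ℕ × ℕ)) (I : ℕ × ℕ)
    (h : vine k n = A ++ I :: B) :
    ∃ g ∈ H, (∀ t : unitInterval, 2 ^ k * (t : ℝ) ≤ 2 ^ k - 1 → g • t = t) ∧
      List.Forall₂ (MapsAffinely g) (vine k (n + 1)) (A ++ leftHalf I :: rightHalf I :: B) := by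
  have h2k : 0 < 2 ^ k := by positivity
  induction A generalizing n k with
  | nil =>
    rcases n with _ | n
    · obtain ⟨rfl, rfl⟩ : (k, 2 ^ k - 1) = I ∧ [] = B := by simpa [vine] using h
      refine ⟨1, H.one_mem, fun t _ => one_smul _ t, ?_⟩
      have e : vine k 1 = [leftHalf (k, 2 ^ k - 1), rightHalf (k, 2 ^ k - 1)] := by
        simp only [vine, leftHalf, rightHalf, pow_succ]
        congr 3 <;> omega
      rw [List.nil_append, ← e, List.forall₂_same]
      exact fun I _ => MapsAffinely.one I
    · obtain ⟨rfl, rfl⟩ : (k + 1, 2 ^ (k + 1) - 2) = I ∧ vine (k + 1) n = B := by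
        simpa [vine] using h
      have hx := two_pow_mul_x k
      -- `x k` carries the first two intervals of the longer vine onto the two halves of `I` and
      -- shifts the remaining ones.
      refine ⟨x k, x_mem k, fun t ht => ?_, .cons ?_ (.cons ?_ ?_)⟩
      · apply Subtype.ext
        have := hx t
        rw [if_pos ht] at this
        exact mul_left_cancel₀ (by positivity) this
      · intro t h1 h2
        have := hx t
        simp only [leftHalf, Nat.cast_mul, Nat.cast_ofNat, cast_two_pow_succ_sub_two] at h1 h2 ⊢
        simp only [pow_succ] at h1 h2 ⊢
        split_ifs at this <;> linarith
      · intro t h1 h2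
        have := hx t
        simp only [rightHalf, Nat.cast_mul, Nat.cast_ofNat, cast_two_pow_succ_sub_two,
          Nat.cast_add, Nat.cast_one] at h1 h2 ⊢
        simp only [pow_succ] at h1 h2 ⊢
        split_ifs at this <;> linarith
      · exact x_shift_vine k (k + 1) n (Nat.lt_succ_self k)
  | cons J A ih =>
    rcases n with _ | n
    · simp [vine] at h
    · obtain ⟨rfl, h'⟩ : (k + 1, 2 ^ (k + 1) - 2) = J ∧ vine (k + 1) n = A ++ I :: B := by
        simpa [vine] using h
      obtain ⟨g, hg, hfix, hmaps⟩ := ih n (k + 1) h' (by positivity)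
      refine ⟨g, hg, fun t ht => hfix t ?_, .cons ?_ hmaps⟩
      · rw [pow_succ]; linarith
      · intro t h1 h2
        simp only [cast_two_pow_succ_sub_two] at h1 h2 ⊢
        rw [hfix t]
        rw [pow_succ] at h2 ⊢
        linarith

theorem IsPartition.le_one {a : ℝ} {l : List (ℕ × ℕ)} (h : IsPartition a l) : a ≤ 1 := by
  induction l generalizing a with
  | nil => exact le_of_eq h
  | cons I l ih =>
    have h1 := ih h.2
    have hp : (0 : ℝ) < 2 ^ I.1 := by positivity
    rw [div_le_one hp, h.1] at h1
    nlinarith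

theorem IsPartition.head_valid {a : ℝ} {I : ℕ × ℕ} {l : List (ℕ × ℕ)}
    (h : IsPartition a (I :: l)) : I.2 + 1 ≤ 2 ^ I.1 := by
  have h1 := h.2.le_one
  rw [div_le_one (by positivity)] at h1
  exact_mod_cast h1

theorem IsPartition.append_congr {a : ℝ} {A R R' : List (ℕ × ℕ)} (h : IsPartition a (A ++ R))
    (hR : ∀ b, IsPartition b R → IsPartition b R') : IsPartition a (A ++ R') := by
  induction A generalizing a with
  | nil => exact hR a h
  | cons I A ih => exact ⟨h.1, ih h.2⟩

theorem IsPartition.merge {b : ℝ} {I : ℕ × ℕ} {B : List (ℕ × ℕ)}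
    (h : IsPartition b (leftHalf I :: rightHalf I :: B)) : IsPartition b (I :: B) := by
  obtain ⟨h1, h2, h3⟩ := h
  simp only [leftHalf, rightHalf, pow_succ, Nat.cast_mul, Nat.cast_ofNat, Nat.cast_add,
    Nat.cast_one] at h1 h3
  refine ⟨by linarith, ?_⟩
  convert h3 using 1
  have hp : (0 : ℝ) < 2 ^ I.1 := by positivity
  field_simp
  ring

theorem exists_first_max {Q : List (ℕ × ℕ)} (hQ : Q ≠ []) :
    ∃ A I B, Q = A ++ I :: B ∧ (∀ J ∈ A, J.1 < I.1) ∧ ∀ J ∈ B, J.1 ≤ I.1 := by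
  induction Q with
  | nil => exact absurd rfl hQ
  | cons J Q ih =>
    by_cases hQ' : Q = []
    · subst hQ'
      exact ⟨[], J, [], rfl, by simp, by simp⟩
    · obtain ⟨A, I, B, rfl, hA, hB⟩ := ih hQ'
      by_cases hJ : J.1 < I.1
      · exact ⟨J :: A, I, B, rfl, by simpa using ⟨hJ, fun a b h => hA (a, b) h⟩, hB⟩
      · refine ⟨[], J, A ++ I :: B, rfl, by simp, fun K hK => ?_⟩
        rcases List.mem_append.1 hK with hK | hK
        · exact (hA K hK).le.trans (not_lt.1 hJ)
        · rcases List.mem_cons.1 hK with rfl | hK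
          · exact not_lt.1 hJ
          · exact (hB K hK).trans (not_lt.1 hJ)

/-- An interval of level below `N` ends at an even multiple of `2⁻ᴺ`. -/
theorem IsPartition.exists_even {a : ℝ} {A R : List (ℕ × ℕ)} {N : ℕ}
    (h : IsPartition a (A ++ R)) (ha : ∃ j : ℕ, 2 ^ N * a = 2 * j) (hA : ∀ J ∈ A, J.1 < N) :
    ∃ b, IsPartition b R ∧ ∃ j : ℕ, 2 ^ N * b = 2 * j := by
  induction A generalizing a with
  | nil => exact ⟨a, h, ha⟩
  | cons I A ih =>
    refine ih h.2 ?_ fun J hJ => hA J (List.mem_cons_of_mem _ hJ)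
    obtain ⟨i, hi⟩ : ∃ i, N = I.1 + 1 + i :=
      ⟨N - (I.1 + 1), by have := hA I List.mem_cons_self; omega⟩
    refine ⟨2 ^ i * (I.2 + 1), ?_⟩
    rw [hi]
    push_cast
    field_simp
    ring

/-- A partition with at least two intervals contains the two halves of some interval. -/
theorem IsPartition.exists_halves {Q : List (ℕ × ℕ)} (h : IsPartition 0 Q) (hQ : 2 ≤ Q.length) :
    ∃ A I B, Q = A ++ leftHalf I :: rightHalf I :: B := by
  -- The first interval of maximal level `N` starts at an even multiple of `2⁻ᴺ`, so it is a left
  -- half. Its right end is an odd multiple, which forces the next interval to have level `N` too.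
  obtain ⟨A, ⟨N, k⟩, B, rfl, hA, hB⟩ := exists_first_max (Q := Q) (by rintro rfl; simp at hQ)
  obtain ⟨b, ⟨hk, hB'⟩, j, hj⟩ := h.exists_even (N := N) ⟨0, by simp⟩ hA
  have hkj : k = 2 * j := by
    simp only at hk
    rw [hj] at hk
    exact_mod_cast hk
  have hp : (0 : ℝ) < 2 ^ N := by positivity
  rcases B with _ | ⟨⟨n, i⟩, B⟩
  · have h1 : (k : ℝ) + 1 = 2 ^ N := by
      have : ((k : ℝ) + 1) / 2 ^ N = 1 := hB'
      rwa [div_eq_one_iff_eq hp.ne'] at this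
    have h1 : k + 1 = 2 ^ N := by exact_mod_cast h1
    rcases N with _ | N
    · rcases A with _ | ⟨J, A⟩
      · simp at hQ
      · have := hA J List.mem_cons_self
        simp at this
    · rw [pow_succ] at h1
      omega
  · obtain ⟨d, rfl⟩ : ∃ d, N = n + d := ⟨N - n, by
      have := hB (n, i) List.mem_cons_self
      simp only at this
      omega⟩
    have hi : 2 ^ d * i = k + 1 := by
      have h1 : (i : ℝ) = 2 ^ n * ((k + 1) / 2 ^ (n + d)) := hB'.1
      rw [pow_add] at h1
      have h2 : (2 : ℝ) ^ d * i = k + 1 := by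
        rw [h1]
        field_simp
      exact_mod_cast h2
    rcases d with _ | d
    · have hval := hB'.head_valid
      simp only at hval
      rcases n with _ | n
      · simp at hval hi
        omega
      · refine ⟨A, (n, j), B, ?_⟩
        have : i = 2 * j + 1 := by simpa [hkj] using hi
        simp [leftHalf, rightHalf, hkj, this]
    · rw [pow_succ, mul_assoc, mul_left_comm] at hi
      omega

/-- Every partition is the image of a vine under an element of `H`. -/
theorem IsPartition.exists_mem {Q : List (ℕ × ℕ)} (h : IsPartition 0 Q) :
    ∃ f ∈ H, List.Forall₂ (MapsAffinely f) (vine 0 (Q.length - 1)) Q := by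
  induction hn : Q.length using Nat.strong_induction_on generalizing Q with
  | _ n ih =>
    subst hn
    by_cases hlen : 2 ≤ Q.length
    -- Merge two halves and apply induction. The subdivision pulls back to halving one interval of
    -- the vine, and that is the image of a longer vine.
    · obtain ⟨A, I, B, rfl⟩ := h.exists_halves hlen
      obtain ⟨f, hf, hmaps⟩ := ih (A ++ I :: B).length (by simp)
        (h.append_congr fun b => IsPartition.merge) rfl
      obtain ⟨A', I', B', hv, hA, hI, hB⟩ := exists_forall₂_append_cons hmaps
      obtain ⟨g, hg, -, hg'⟩ := exists_mem_vine_halve _ _ A' B' I' hv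
      refine ⟨f * g, H.mul_mem hf hg, ?_⟩
      have hlen' : (A ++ leftHalf I :: rightHalf I :: B).length - 1 =
          (A ++ I :: B).length - 1 + 1 := by
        simp
        omega
      rw [hlen']
      exact forall₂_mul (List.rel_append hA (.cons hI.leftHalf (.cons hI.rightHalf hB))) hg'
    · obtain _ | ⟨⟨n, k⟩, _ | ⟨J, Q⟩⟩ := Q
      · exact absurd h zero_ne_one
      · obtain ⟨h1, h2⟩ := h
        have h1 : k = 0 := by simpa using h1
        subst h1
        have h2 : ((0 : ℕ) + 1 : ℝ) / 2 ^ n = 1 := h2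
        rw [div_eq_one_iff_eq (by positivity)] at h2
        have h2 : 0 + 1 = 2 ^ n := by exact_mod_cast h2
        have : n = 0 := by
          rcases n with _ | n
          · rfl
          · rw [pow_succ] at h2; omega
        subst this
        exact ⟨1, H.one_mem, .cons (MapsAffinely.one _) .nil⟩
      · simp at hlen

/-! ### Elements of `F` on fine uniform partitions -/

/-- The images of the intervals of a uniform partition form a partition. -/
theorem isPartition_map {f : F} {N : ℕ} {J : ℕ → ℕ × ℕ}
    (hJ : ∀ k < 2 ^ N, MapsAffinely f (N, k) (J k)) (c k : ℕ) (hk : k + c = 2 ^ N)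
    (p : unitInterval) (hp : 2 ^ N * (p : ℝ) = k) :
    IsPartition (f • p : unitInterval) ((List.range' k c).map J) := by
  have hN : (0 : ℝ) < 2 ^ N := by positivity
  induction c generalizing k p with
  | zero =>
    have : p = 1 := by
      apply Subtype.ext
      rw [add_zero] at hk
      rw [hk] at hp
      push_cast at hp
      exact mul_left_cancel₀ hN.ne' (hp.trans (mul_one _).symm)
    rw [this]
    change (((f : unitInterval ≃o unitInterval) ⊤ : unitInterval) : ℝ) = 1
    rw [OrderIso.map_top]
    rfl
  | succ c ih =>
    have hkN : ((k : ℝ) + 1) ≤ 2 ^ N := by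
      have : k + 1 ≤ 2 ^ N := by omega
      exact_mod_cast this
    have hm := hJ k (by omega)
    let q : unitInterval := ⟨(k + 1) / 2 ^ N, by positivity, by rwa [div_le_one hN]⟩
    have hq : 2 ^ N * (q : ℝ) = k + 1 := mul_div_cancel₀ _ hN.ne'
    have h1 := hm p hp.ge (by simp only; linarith)
    have h2 := hm q (by simp only; linarith) hq.le
    simp only at h1 h2
    refine ⟨by linarith, ?_⟩
    have h3 := ih (k + 1) (by omega) q (by push_cast; exact hq)
    convert h3 using 1
    rw [div_eq_iff (by positivity)]
    linarith

theorem exists_isInt_mul_two_pow (S : Finset unitInterval) (hS : ∀ s ∈ S, IsDyadic s) :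
    ∃ N : ℕ, ∀ s ∈ S, ∃ z : ℤ, 2 ^ N * (s : ℝ) = z := by
  choose! z n h using hS
  refine ⟨S.sup n, fun s hs => ⟨2 ^ (S.sup n - n s) * z s, ?_⟩⟩
  obtain ⟨d, hd⟩ : ∃ d, S.sup n = n s + d :=
    ⟨S.sup n - n s, by have := Finset.le_sup (f := n) hs; omega⟩
  rw [h s hs, hd, pow_add]
  push_cast
  rw [Nat.add_sub_cancel_left]
  field_simp

/-- An element of `F` maps the intervals of a sufficiently fine uniform partition affinely onto
standard dyadic intervals. -/
theorem exists_mapsAffinely (f : F) :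
    ∃ N : ℕ, ∀ k < 2 ^ N, ∃ J, MapsAffinely f (N, k) J := by
  obtain ⟨S, hS, hA⟩ := f.2
  obtain ⟨N₀, hN₀⟩ := exists_isInt_mul_two_pow S hS
  have hp₀ : (0 : ℝ) < 2 ^ N₀ := by positivity
  have hloc : ∀ k < 2 ^ N₀, ∃ M : ℕ, ∀ d ≥ M, ∀ i : ℕ, k * 2 ^ d ≤ i → i + 1 ≤ (k + 1) * 2 ^ d →
      ∃ J, MapsAffinely f (N₀ + d, i) J := by
    intro k hk
    have hk' : (k : ℝ) + 1 ≤ 2 ^ N₀ := by exact_mod_cast hk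
    let u : unitInterval := ⟨k / 2 ^ N₀, by positivity, by rw [div_le_one hp₀]; linarith⟩
    let v : unitInterval := ⟨(k + 1) / 2 ^ N₀, by positivity, by rwa [div_le_one hp₀]⟩
    have hu : 2 ^ N₀ * (u : ℝ) = k := mul_div_cancel₀ _ hp₀.ne'
    have hv : 2 ^ N₀ * (v : ℝ) = k + 1 := mul_div_cancel₀ _ hp₀.ne'
    have huv : u ≤ v := by
      rw [← Subtype.coe_le_coe, ← mul_le_mul_iff_right₀ hp₀]
      linarith
    obtain ⟨e, c, hec⟩ := hA u v huv (by
      rintro s hs ⟨h1, h2⟩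
      obtain ⟨z, hz⟩ := hN₀ s hs
      have h1 := mul_lt_mul_of_pos_left (Subtype.coe_lt_coe.2 h1) hp₀
      have h2 := mul_lt_mul_of_pos_left (Subtype.coe_lt_coe.2 h2) hp₀
      rw [hu, hz] at h1
      rw [hv, hz] at h2
      have h1 : (k : ℤ) < z := by exact_mod_cast h1
      have h2 : z < (k : ℤ) + 1 := by exact_mod_cast h2
      omega)
    have hdu : IsDyadic (u : ℝ) := ⟨k, N₀, by simp [u]⟩
    -- `f` preserves dyadic points, so the constant term is dyadic on an interval with dyadic left
    -- end.
    have hc : IsDyadic c := by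
      have h1 := ((IsDyadicPL.isDyadic_iff f.2 u).2 hdu).sub (hdu.zpow_mul e)
      rw [hec u le_rfl huv] at h1
      simpa using h1
    obtain ⟨z, n, hz⟩ := hc
    refine ⟨n + e.toNat, fun d hd i hi1 hi2 => ?_⟩
    -- An interval of length `2^-(N₀+d)` has an image of length `2^-(n+r)`. The bound on `d` makes
    -- `r ≥ 0`, so that `c = z / 2ⁿ` is a multiple of that length.
    obtain ⟨r, hr⟩ : ∃ r : ℕ, (N₀ + d : ℤ) - e = n + r :=
      ⟨((N₀ + d : ℤ) - e - n).toNat, by omega⟩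
    have hpow : (2 : ℝ) ^ (n + r) * 2 ^ e = 2 ^ (N₀ + d) := by
      rw [← zpow_natCast, ← zpow_natCast, ← zpow_add₀ two_ne_zero]
      congr 1
      push_cast
      omega
    have hpd : (0 : ℝ) < 2 ^ d := by positivity
    have hrange : ∀ t : unitInterval, (i : ℝ) ≤ 2 ^ (N₀ + d) * t →
        2 ^ (N₀ + d) * (t : ℝ) ≤ i + 1 →
        2 ^ (n + r) * ((f • t : unitInterval) : ℝ) = 2 ^ (N₀ + d) * t + 2 ^ r * z := by
      intro t h1 h2
      have hi1 : (k : ℝ) * 2 ^ d ≤ i := by exact_mod_cast hi1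
      have hi2 : (i : ℝ) + 1 ≤ (k + 1) * 2 ^ d := by exact_mod_cast hi2
      have e1 : u ≤ t := by
        rw [← Subtype.coe_le_coe, ← mul_le_mul_iff_right₀ hp₀, hu,
          ← mul_le_mul_iff_left₀ hpd]
        rw [pow_add] at h1
        linarith
      have e2 : t ≤ v := by
        rw [← Subtype.coe_le_coe, ← mul_le_mul_iff_right₀ hp₀, hv,
          ← mul_le_mul_iff_left₀ hpd]
        rw [pow_add] at h2
        linarith
      have := hec t e1 e2
      change (2 : ℝ) ^ (n + r) * (((f : unitInterval ≃o unitInterval) t : unitInterval) : ℝ) = _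
      rw [this, mul_add, ← mul_assoc, hpow, hz, pow_add]
      field_simp
      ring
    have hp : (0 : ℝ) < 2 ^ (N₀ + d) := by positivity
    have hile : (i : ℝ) ≤ 2 ^ (N₀ + d) := by
      have : i ≤ 2 ^ (N₀ + d) := by
        rw [pow_add]
        have : (k + 1) * 2 ^ d ≤ 2 ^ N₀ * 2 ^ d := Nat.mul_le_mul_right _ hk
        omega
      exact_mod_cast this
    let q : unitInterval := ⟨i / 2 ^ (N₀ + d), by positivity, by rwa [div_le_one hp]⟩
    have hq : 2 ^ (N₀ + d) * (q : ℝ) = i := mul_div_cancel₀ _ hp.ne'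
    have h1 := hrange q hq.ge (by linarith)
    rw [hq] at h1
    obtain ⟨j, hj⟩ : ∃ j : ℕ, (i : ℤ) + 2 ^ r * z = j := by
      apply Int.eq_ofNat_of_zero_le
      have : (0 : ℝ) ≤ i + 2 ^ r * z := by
        rw [← h1]
        exact mul_nonneg (by positivity) (f • q).2.1
      exact_mod_cast this
    refine ⟨(n + r, j), fun t h2 h3 => ?_⟩
    have hj' : (i : ℝ) + 2 ^ r * z = j := by exact_mod_cast hj
    rw [hrange t h2 h3, ← hj']
    ring
  choose! M hM using hloc
  -- One depth for all coarse intervals; the fine interval `i` lies in the coarse interval `i / 2 ^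
  -- d`.
  set d := (Finset.range (2 ^ N₀)).sup M with hd
  refine ⟨N₀ + d, fun i hi => ?_⟩
  have h2d : 0 < 2 ^ d := by positivity
  have hlt : i / 2 ^ d < 2 ^ N₀ := by
    rw [Nat.div_lt_iff_lt_mul h2d, ← pow_add]
    exact hi
  refine hM (i / 2 ^ d) hlt d (Finset.le_sup (Finset.mem_range.2 hlt)) i
    (Nat.div_mul_le_self _ _) ?_
  have h1 := Nat.div_add_mod i (2 ^ d)
  have h2 := Nat.mod_lt i h2d
  rw [add_mul, one_mul, mul_comm]
  omega

/-- The uniform partition and its image under `f` have equally many intervals, so they are images of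
the same vine under some `p, q ∈ H`. Then `f` and `q p⁻¹` agree on every interval. -/
theorem H_eq_top : H = ⊤ := by
  rw [eq_top_iff]
  intro f _
  obtain ⟨N, hN⟩ := exists_mapsAffinely f
  choose! J hJ using hN
  have h0 : 2 ^ N * ((0 : unitInterval) : ℝ) = (0 : ℕ) := by simp
  have part : ∀ (g : F) (J' : ℕ → ℕ × ℕ), (∀ k < 2 ^ N, MapsAffinely g (N, k) (J' k)) →
      IsPartition 0 ((List.range (2 ^ N)).map J') := by
    intro g J' hJ'
    have := isPartition_map hJ' (2 ^ N) 0 (zero_add _) 0 h0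
    have hg : g • (0 : unitInterval) = 0 := (g : unitInterval ≃o unitInterval).map_bot
    rwa [hg, ← List.range_eq_range'] at this
  obtain ⟨p, hp, hp'⟩ := (part 1 (fun k => (N, k)) fun k _ => MapsAffinely.one _).exists_mem
  obtain ⟨q, hq, hq'⟩ := (part f J hJ).exists_mem
  rw [List.length_map] at hp' hq'
  have hmaps := forall₂_mul hq' (forall₂_inv hp' (vine_valid _ _))
  rw [List.forall₂_map_left_iff, List.forall₂_map_right_iff, List.forall₂_same] at hmaps
  have hf : f = q * p⁻¹ := by
    apply Subtype.ext
    apply OrderIso.ext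
    funext t
    change f • t = (q * p⁻¹) • t
    obtain ⟨k, hk, h1, h2⟩ : ∃ k : ℕ, k < 2 ^ N ∧ (k : ℝ) ≤ 2 ^ N * t ∧ 2 ^ N * (t : ℝ) ≤ k + 1 := by
      rcases t.2.2.lt_or_eq with ht | ht
      · obtain ⟨k, hk, h1, h2⟩ := exists_grid N ht
        exact ⟨k, hk, h1, h2.le⟩
      · have hpos : 0 < 2 ^ N := by positivity
        refine ⟨2 ^ N - 1, by omega, ?_, ?_⟩ <;> rw [cast_two_pow_sub_one, ht] <;> linarith
    have e1 := hJ k hk t h1 h2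
    have e2 := hmaps k (List.mem_range.2 hk) t h1 h2
    apply Subtype.ext
    have hpos : (0 : ℝ) < 2 ^ (J k).1 := by positivity
    exact mul_left_cancel₀ hpos.ne' (by linarith)
  rw [hf]
  exact H.mul_mem hq (H.inv_mem hp)

theorem closure_generators {m : ℕ} (g : Fin m → F) :
    Subgroup.closure (range (Fin.append g ![x 0, x 1])) = ⊤ := by
  rw [eq_top_iff, ← H_eq_top, H, Subgroup.closure_le]
  have h : ∀ j, ![x 0, x 1] j ∈ Subgroup.closure (range (Fin.append g ![x 0, x 1])) :=
    fun j => Subgroup.subset_closure ⟨Fin.natAdd m j, Fin.append_right _ _ _⟩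
  rintro _ (rfl | rfl)
  · exact h 0
  · exact h 1

instance countable : Countable F :=
  WordLimit.countable_of_closure_eq_top (closure_generators (m := 0) Fin.elim0)

end Thompson

end

theorem corollary3p4 :
    (∀ (m : ℕ) (W : Set (WordLimit.Word m Thompson.F)),
      (∀ w ∈ W, WordLimit.IsOscillating unitInterval w ∨
        WordLimit.IsAlmostOscillating unitInterval w ∨ WordLimit.HasNontrivialProduct w) →
      ∃ g : ℕ → Fin m → Thompson.F,
        (∀ n, Subgroup.closure
          (Set.range (Fin.append (g n) ![Thompson.x 0, Thompson.x 1])) = ⊤) ∧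
        WordLimit.IsWLimit W (fun _ => MonoidHom.id Thompson.F) g
          (Monoid.Coprod.inr : Thompson.F →* Monoid.Coprod (FreeGroup (Fin m)) Thompson.F)
          (fun i => Monoid.Coprod.inl (FreeGroup.of i))) ∧
    (∀ (m : ℕ) (W : Set (WordLimit.Word m Grigorchuk.Γ)),
      (∀ w ∈ W, WordLimit.IsOscillating Grigorchuk.Boundary w ∨
        WordLimit.IsAlmostOscillating Grigorchuk.Boundary w ∨
        WordLimit.HasNontrivialProduct w) →
      ∃ g : ℕ → Fin m → Grigorchuk.Γ,
        (∀ n, Subgroup.closure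
          (Set.range (Fin.append (g n)
            ![Grigorchuk.a, Grigorchuk.b, Grigorchuk.c, Grigorchuk.d])) = ⊤) ∧
        WordLimit.IsWLimit W (fun _ => MonoidHom.id Grigorchuk.Γ) g
          (Monoid.Coprod.inr : Grigorchuk.Γ →* Monoid.Coprod (FreeGroup (Fin m)) Grigorchuk.Γ)
          (fun i => Monoid.Coprod.inl (FreeGroup.of i))) := by
  refine ⟨fun m W hW => ?_, fun m W hW => ?_⟩
  · obtain ⟨g, hg⟩ := Thompson.isSeparatingFiltration.exists_isWLimit W hW
    exact ⟨g, fun n => Thompson.closure_generators (g n), hg⟩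
  · obtain ⟨g, hg⟩ := Grigorchuk.isSeparatingFiltration.exists_isWLimit W hW
    exact ⟨g, fun n => Grigorchuk.closure_generators (g n), hg⟩
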